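/- Let $\Lambda\subset\mathbb R^d$ be a lattice (a discrete subgroup spanning $\mathbb R^d$) with a quantum spin $\mathbb C^q$, $q\ge 1$, at every site, and let $H=\sum_{x\in\Lambda}h_x$ be a Hamiltonian whose Hermitian terms are uniformly bounded, $\sup_x\|h_x\|<\infty$, each $h_x$ being supported within a fixed distance of $x$ (translation invariance is not required). Let $O_1,O_2$ be finitely supported operators. For $y\in\Lambda$, $O(y,0)$ denotes $O$ translated by $y$; $O(0,t)$ is the Heisenberg evolution of $O$ on the infinite lattice, i.e. the operator-norm limit of $e^{itH_V}Oe^{-itH_V}$, $H_V=\sum_{x\in V}h_x$, along the finite sets $V\subset\Lambda$ increasing to $\Lambda$. Let $\boldsymbol n\in\mathbb R^d$ be a unit vector. To give meaning to $O_2(x\boldsymbol n,0)$, let $X\subset\mathbb R$ be a set of admissible distances that is not bounded above, and for $x\in X$ let $p(x)\in\Lambda$ be a lattice vector representing $x\boldsymbol n$, with $\sup_{x\in X}|p(x)-x\boldsymbol n|<\infty$. (Examples: $X=\{x: x\boldsymbol n\in\Lambda\}$ and $p(x)=x\boldsymbol n$, if $\boldsymbol n$ is the direction of a nonzero lattice vector;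 or $X=\mathbb R$ and $p(x)$ a lattice point nearest to $x\boldsymbol n$, for any direction.) Put $$f(x,t)=\|[O_1(0,t),O_2(p(x),0)]\| ,\qquad x\in X .$$ Let $v^{(1)}_{\mathrm{LR}}\in[0,\infty]$ be the infimum of all $v>0$ for which there are $\xi,C>0$ such that $$f(x,t)\le C\,\|O_1\|\,\|O_2\|\,\min\{1,e^{(vt-x)/\xi}\}\quad\text{for all } t>0 \text{ and all } x\in X,\ x>0,$$ and let $v^{(2)}_{\mathrm{LR}}\in[0,\infty]$ be the supremum ($0$ if there are none) of all $v>0$ for which the limit $$\lim_{t\to\infty,\ vt\in X}\ \frac1t\ln f(vt,t)\in[-\infty,\infty]$$ exists and is $\ge 0$, where $\ln 0=-\infty$. Then: 1. the limit defining $O_1(0,t)$ exists for every $t\in\mathbb R$, and $v^{(1)}_{\mathrm{LR}}<\infty$; 2. $v^{(1)}_{\mathrm{LR}}\ge v^{(2)}_{\mathrm{LR}}$; 3. if, as $t\to\infty$ with $vt\in X$, $\frac1t\ln f(vt,t)$ converges to a limit $\lambda(v)\in[-\infty,\infty)$ uniformly for all $v>v^{(2)}_{\mathrm{LR}}$, then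 $v^{(1)}_{\mathrm{LR}}\le v^{(2)}_{\mathrm{LR}}$, hence $v^{(1)}_{\mathrm{LR}}=v^{(2)}_{\mathrm{LR}}$. Here uniform convergence is with respect to the uniformity of $[-\infty,\infty)$ in which $a,b$ are $\varepsilon$-close if $a\le\max(b+\varepsilon,-1/\varepsilon)$ and $b\le\max(a+\varepsilon,-1/\varepsilon)$; for finite values it is implied by uniform convergence in the usual sense, $\sup_v|\frac1t\ln f(vt,t)-\lambda(v)|\to0$. -/

import Mathlib

open Filter Topology

noncomputable section

namespace SpinLattice

/-- Physical space `ℝᵈ` with the Euclidean norm. -/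
abbrev Space (d : ℕ) : Type := EuclideanSpace ℝ (Fin d)

variable {d : ℕ} (Λ : Submodule ℤ (Space d)) (q : ℕ) [NeZero q]

/-- Spin configurations on the lattice `Λ` with `q` states per site which differ from the reference
configuration (all spins in state `0`) at finitely many sites. -/
abbrev Config : Type := Λ →₀ Fin q

/-- The infinite tensor product of the one-site spaces `ℂ^q` along the reference configuration:
its orthonormal basis is indexed by `Config Λ q`. -/
abbrev HilbertSp : Type := lp (fun _ : Config Λ q => ℂ) 2

/-- Bounded operators, with the operator norm. They contain the local operators of the lattice,
and the norm closure of the latter is the quasi-local algebra. -/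
abbrev Op : Type := HilbertSp Λ q →L[ℂ] HilbertSp Λ q

variable {Λ q}

open Classical in
/-- The basis vector of a configuration. -/
def ket (τ : Config Λ q) : HilbertSp Λ q := lp.single 2 τ (1 : ℂ)

/-- The matrix element `⟨σ| A |τ⟩`. -/
def matrixElement (A : Op Λ q) (σ τ : Config Λ q) : ℂ := A (ket τ) σ

/-- `A` is supported on the set of sites `S`, i.e. it is of the form `a ⊗ 1` with `a` acting on the
sites in `S`: its matrix elements vanish between configurations that differ outside `S`, and
otherwise they depend only on the restrictions of the two configurations to `S`. -/
def IsSupportedOn (S : Set Λ) (A : Op Λ q) : Prop :=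
  (∀ σ τ : Config Λ q, (∃ x, x ∉ S ∧ σ x ≠ τ x) → matrixElement A σ τ = 0) ∧
  (∀ σ τ σ' τ' : Config Λ q, (∀ x, x ∉ S → σ x = τ x) → (∀ x, x ∉ S → σ' x = τ' x) →
    (∀ x, x ∈ S → σ x = σ' x) → (∀ x, x ∈ S → τ x = τ' x) →
    matrixElement A σ τ = matrixElement A σ' τ')

/-- Operators supported on finitely many sites. -/
def IsLocal (A : Op Λ q) : Prop := ∃ S : Finset Λ, IsSupportedOn (S : Set Λ) A

/-- Relabelling the basis by a permutation `e` of the configurations: `(U ψ)(σ) = ψ (e σ)`. -/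
def permute (e : Equiv.Perm (Config Λ q)) : HilbertSp Λ q ≃ₗᵢ[ℂ] HilbertSp Λ q :=
  have mem : ∀ (e : Equiv.Perm (Config Λ q)) (ψ : HilbertSp Λ q),
      Memℓp (fun σ => ψ (e σ)) 2 := fun e ψ =>
    memℓp_gen (((lp.memℓp ψ).summable (by norm_num)).comp_injective e.injective)
  { toFun := fun ψ => ⟨fun σ => ψ (e σ), mem e ψ⟩
    invFun := fun ψ => ⟨fun σ => ψ (e.symm σ), mem e.symm ψ⟩
    map_add' := fun _ _ => rfl
    map_smul' := fun _ _ => rfl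
    left_inv := fun ψ => by ext σ; simp
    right_inv := fun ψ => by ext σ; simp
    norm_map' := fun ψ => by
      rw [lp.norm_eq_tsum_rpow (by norm_num), lp.norm_eq_tsum_rpow (by norm_num)]
      congr 1
      exact Equiv.tsum_eq e (fun σ => ‖ψ σ‖ ^ (2 : ENNReal).toReal) }

/-- The configuration shifted by `-y`, i.e. `x ↦ σ (x + y)`. -/
def shiftConfig (y : Λ) : Equiv.Perm (Config Λ q) :=
  Finsupp.equivCongrLeft (Equiv.subRight y)

/-- The unitary translation by the lattice vector `y`: it maps the basis vector of `σ` to the basis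
vector of `x ↦ σ (x - y)`. -/
def translation (y : Λ) : HilbertSp Λ q ≃ₗᵢ[ℂ] HilbertSp Λ q := permute (shiftConfig y)

/-- The operator `A` translated in space by the lattice vector `y`. -/
def translate (y : Λ) (A : Op Λ q) : Op Λ q :=
  ((translation (q := q) y).toContinuousLinearEquiv : Op Λ q) * A *
    ((translation (q := q) y).symm.toContinuousLinearEquiv : Op Λ q)

variable (Λ q) in
/-- A local Hamiltonian `H = ∑ₓ hₓ`: uniformly bounded Hermitian terms, `hₓ` being supported within
distance `range` from the site `x`. Translation invariance is not required. -/
structure Hamiltonian where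
  /-- the local terms -/
  term : Λ → Op Λ q
  /-- the interaction range -/
  range : ℝ
  selfAdjoint : ∀ x, IsSelfAdjoint (term x)
  supported : ∀ x, IsSupportedOn {y | dist y x < range} (term x)
  bounded : ∃ J : ℝ, ∀ x, ‖term x‖ ≤ J

/-- The Hamiltonian of the finite subsystem `V`. -/
def Hamiltonian.restrict (H : Hamiltonian Λ q) (V : Finset Λ) : Op Λ q := ∑ x ∈ V, H.term x

/-- Heisenberg evolution `e^{i t H_V} A e^{-i t H_V}` with the Hamiltonian of the finite
subsystem `V`. -/
def Hamiltonian.evolveIn (H : Hamiltonian Λ q) (V : Finset Λ) (t : ℝ) (A : Op Λ q) : Op Λ q :=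
  NormedSpace.exp ((Complex.I * (t : ℂ)) • H.restrict V) * A *
    NormedSpace.exp (-((Complex.I * (t : ℂ)) • H.restrict V))

/-- Heisenberg evolution on the infinite lattice: the operator norm limit of the evolutions of
increasing finite subsystems. -/
def Hamiltonian.evolve (H : Hamiltonian Λ q) (t : ℝ) (A : Op Λ q) : Op Λ q :=
  limUnder atTop (fun V : Finset Λ => H.evolveIn V t A)

/-- The commutator `[O₁(0, t), O₂(y, 0)]`. -/
def Hamiltonian.commutator (H : Hamiltonian Λ q) (O₁ O₂ : Op Λ q) (t : ℝ) (y : Λ) : Op Λ q :=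
  H.evolve t O₁ * translate y O₂ - translate y O₂ * H.evolve t O₁

section Velocities

/- In the following `X` is a set of distances along a ray and `p x`, for `x ∈ X`, is the lattice
vector which represents the point at distance `x` from the origin on the ray. -/
variable (H : Hamiltonian Λ q) (X : Set ℝ) (p : ℝ → Λ) (O₁ O₂ : Op Λ q)

/-- The velocity `v` admits an exponential Lieb-Robinson bound along the ray. -/
def LiebRobinsonBound (v : ℝ) : Prop :=
  ∃ ξ C : ℝ, 0 < ξ ∧ 0 < C ∧ ∀ t x : ℝ, 0 < t → 0 < x → x ∈ X →
    ‖H.commutator O₁ O₂ t (p x)‖ ≤ C * ‖O₁‖ * ‖O₂‖ * min 1 (Real.exp ((v * t - x) / ξ))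

/-- The infimum (in `[0, ∞]`, with `inf ∅ = ∞`) of the velocities `v > 0` which admit an exponential
Lieb-Robinson bound. -/
def velocity₁ : ENNReal :=
  ⨅ v ∈ {v : ℝ | 0 < v ∧ LiebRobinsonBound H X p O₁ O₂ v}, ENNReal.ofReal v

/-- The growth rate `t⁻¹ ln ‖[O₁(0, t), O₂(p (v t), 0)]‖` at time `t`, with `ln 0 = -∞`. -/
def growthRate (v t : ℝ) : EReal :=
  ((t⁻¹ : ℝ) : EReal) * ENNReal.log ‖H.commutator O₁ O₂ t (p (v * t))‖ₑ

/-- The limit of the growth rate along the ray `x = v t`, as `t → ∞` with `v t ∈ X`, exists and is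
equal to `l`. -/
def HasRayLimit (v : ℝ) (l : EReal) : Prop :=
  Tendsto (growthRate H p O₁ O₂ v) (atTop ⊓ 𝓟 {t | v * t ∈ X}) (𝓝 l)

/-- The supremum (in `[0, ∞]`, with `sup ∅ = 0`) of the velocities `v > 0` along whose ray the limit
of the growth rate is nonnegative. -/
def velocity₂ : ENNReal :=
  ⨆ v ∈ {v : ℝ | 0 < v ∧ ∃ l : EReal, HasRayLimit H X p O₁ O₂ v l ∧ 0 ≤ l}, ENNReal.ofReal v

/-- The growth rate converges to `lam v`, as `t → ∞` with `v t ∈ X`, uniformly for `v ∈ W`.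
Rates take values in `[-∞, ∞)`, where `a` and `b` are `ε`-close if `a ≤ max (b + ε) (-1/ε)` and
`b ≤ max (a + ε) (-1/ε)`; these relations form a basis of the uniformity of `[-∞, ∞)` with the
neighbourhoods `[-∞, -1/ε]` of `-∞`. They follow from `|a - b| ≤ ε` for finite `a` and `b`. -/
def UniformRayLimit (W : Set ℝ) (lam : ℝ → EReal) : Prop :=
  ∀ ε : ℝ, 0 < ε → ∃ T : ℝ, 0 < T ∧ ∀ t : ℝ, T ≤ t → ∀ v ∈ W, v * t ∈ X →
    growthRate H p O₁ O₂ v t ≤ max (lam v + (ε : EReal)) ((-1 / ε : ℝ) : EReal) ∧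
    lam v ≤ max (growthRate H p O₁ O₂ v t + (ε : EReal)) ((-1 / ε : ℝ) : EReal)

end Velocities

end SpinLattice

end

/-!
In the interaction picture with respect to the part of the Hamiltonian that commutes with `h_z`, the
norm of `[h_z, B(t)]` grows only through the terms which overlap with `h_z`. Since these are close
to `z`, Grönwall's inequality applies in the supremum norm weighted by `exp (-‖z‖)`, uniformly in
the volume: if `B` is local, then `‖[h_z, B(t)]‖ ≤ D exp (K|t| - ‖z‖)`. By Duhamel's formula the
finite-volume evolutions of a local operator are Cauchy, and the bound for a local operator `A` in
place of `h_z` is a Lieb-Robinson bound for any pair of local operators.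

The comparison of the velocities concerns only a function `f x t` that is continuous in `t` and
obeys some cone bound. Along a ray steeper than an admissible cone `f` decays exponentially, hence
`v⁽²⁾ ≤ v⁽¹⁾`. Conversely, a uniform limit of the growth rates is upper semicontinuous in the
velocity: the rays of nearby velocities pass through the same point `x` at nearby times. A negative
rate is therefore bounded away from zero on the compact interval between a velocity above `v⁽²⁾` and
twice the velocity of the known cone. This yields uniform exponential decay between the two cones,
and beyond the second one the known bound is small enough.
-/

noncomputable section

namespace SpinLattice

section Commutator

variable {R : Type*} [NonUnitalSeminormedRing R]

theorem norm_lie_le (A B : R) : ‖⁅A, B⁆‖ ≤ 2 * ‖A‖ * ‖B‖ :=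
  calc ‖⁅A, B⁆‖ ≤ ‖A * B‖ + ‖B * A‖ := norm_sub_le _ _
    _ ≤ ‖A‖ * ‖B‖ + ‖B‖ * ‖A‖ := add_le_add (norm_mul_le A B) (norm_mul_le B A)
    _ = 2 * ‖A‖ * ‖B‖ := by ring

theorem norm_lie_comm (A B : R) : ‖⁅A, B⁆‖ = ‖⁅B, A⁆‖ := norm_sub_rev _ _

end Commutator

section Heisenberg

attribute [local instance] LieRing.ofAssociativeRing LieAlgebra.ofAssociativeAlgebra

section BanachAlgebra

variable {𝔸 : Type*} [NormedRing 𝔸] [NormedAlgebra ℂ 𝔸]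

/-- The Heisenberg evolution `e^{itH} A e^{-itH}` of the observable `A` under the Hamiltonian `H`,
which may be any element of a Banach algebra. -/
def heisenberg (H : 𝔸) (t : ℝ) (A : 𝔸) : 𝔸 :=
  NormedSpace.exp ((Complex.I * (t : ℂ)) • H) * A *
    NormedSpace.exp (-((Complex.I * (t : ℂ)) • H))

/-- The evolution `e^{-itK} e^{itH} A e^{-itH} e^{itK}` of the observable `A` in the interaction
picture, in which only the part `H - K` of the Hamiltonian `H` is felt. -/
def interactionPicture (K H : 𝔸) (t : ℝ) (A : 𝔸) : 𝔸 := heisenberg (-K) t (heisenberg H t A)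

@[simp]
theorem heisenberg_zero_time (H A : 𝔸) : heisenberg H 0 A = A := by
  simp [heisenberg]

theorem heisenberg_neg (H : 𝔸) (t : ℝ) (A : 𝔸) : heisenberg (-H) t A = heisenberg H (-t) A := by
  simp [heisenberg]

theorem heisenberg_sub (H : 𝔸) (t : ℝ) (A B : 𝔸) :
    heisenberg H t (A - B) = heisenberg H t A - heisenberg H t B := by
  simp [heisenberg, mul_sub, sub_mul]

theorem heisenberg_smul (H : 𝔸) (t : ℝ) (c : ℂ) (A : 𝔸) :
    heisenberg H t (c • A) = c • heisenberg H t A := by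
  simp [heisenberg]

@[simp]
theorem interactionPicture_zero_time (K H A : 𝔸) : interactionPicture K H 0 A = A := by
  simp [interactionPicture]

variable [CompleteSpace 𝔸]

theorem heisenberg_add_time (H : 𝔸) (s t : ℝ) (A : 𝔸) :
    heisenberg H (s + t) A = heisenberg H s (heisenberg H t A) := by
  let _ : NormedAlgebra ℚ 𝔸 := .restrictScalars ℚ ℂ 𝔸
  have hc : Commute ((Complex.I * (s : ℂ)) • H) ((Complex.I * (t : ℂ)) • H) :=
    ((Commute.refl H).smul_left _).smul_right _
  simp only [heisenberg, Complex.ofReal_add, mul_add, add_smul]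
  rw [NormedSpace.exp_add_of_commute hc, neg_add_rev,
    NormedSpace.exp_add_of_commute hc.symm.neg_left.neg_right]
  simp only [mul_assoc]

theorem heisenberg_neg_heisenberg (H : 𝔸) (t : ℝ) (A : 𝔸) :
    heisenberg (-H) t (heisenberg H t A) = A := by
  rw [heisenberg_neg, ← heisenberg_add_time, neg_add_cancel, heisenberg_zero_time]

theorem heisenberg_mul (H : 𝔸) (t : ℝ) (A B : 𝔸) :
    heisenberg H t (A * B) = heisenberg H t A * heisenberg H t B := by
  let _ : NormedAlgebra ℚ 𝔸 := .restrictScalars ℚ ℂ 𝔸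
  have hinv : NormedSpace.exp (-((Complex.I * (t : ℂ)) • H)) *
      NormedSpace.exp ((Complex.I * (t : ℂ)) • H) = 1 := by
    rw [← NormedSpace.exp_add_of_commute (Commute.refl _).neg_left, neg_add_cancel,
      NormedSpace.exp_zero]
  simp only [heisenberg, mul_assoc]
  rw [← mul_assoc (NormedSpace.exp (-_)) (NormedSpace.exp _), hinv, one_mul]

theorem heisenberg_lie (H : 𝔸) (t : ℝ) (A B : 𝔸) :
    heisenberg H t ⁅A, B⁆ = ⁅heisenberg H t A, heisenberg H t B⁆ := by
  simp only [Ring.lie_def, heisenberg_sub, heisenberg_mul]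

theorem heisenberg_eq_self_of_lie_eq_zero {H A : 𝔸} (hA : ⁅A, H⁆ = 0) (t : ℝ) :
    heisenberg H t A = A := by
  let _ : NormedAlgebra ℚ 𝔸 := .restrictScalars ℚ ℂ 𝔸
  have hsemi : SemiconjBy A (-((Complex.I * (t : ℂ)) • H)) (-((Complex.I * (t : ℂ)) • H)) :=
    ((commute_iff_lie_eq.2 hA).smul_right _).neg_right
  simpa [heisenberg] using hsemi.exp_neg_mul_mul_exp_eq_self

theorem lie_heisenberg_self (H : 𝔸) (t : ℝ) (A : 𝔸) :
    ⁅H, heisenberg H t A⁆ = heisenberg H t ⁅H, A⁆ := by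
  rw [heisenberg_lie, heisenberg_eq_self_of_lie_eq_zero (lie_self H)]

theorem hasDerivAt_heisenberg_comp (H : 𝔸) {F : ℝ → 𝔸} {F' : 𝔸} {s : ℝ}
    (hF : HasDerivAt F F' s) :
    HasDerivAt (fun r => heisenberg H r (F r))
      (heisenberg H s (Complex.I • ⁅H, F s⁆ + F')) s := by
  have hexp := ((hasDerivAt_exp_smul_const (𝕂 := ℝ) (Complex.I • H) s).mul hF).mul
    (hasDerivAt_exp_smul_const' (𝕂 := ℝ) (-(Complex.I • H)) s)
  have hsmul : ∀ r : ℝ, (Complex.I * (r : ℂ)) • H = r • (Complex.I • H) := fun r => by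
    rw [mul_comm, mul_smul, Complex.coe_smul]
  have hprod : ∀ U V x y : 𝔸, (U * (Complex.I • H) * x + U * y) * V +
      U * x * (-(Complex.I • H) * V) = U * (Complex.I • ⁅H, x⁆ + y) * V := fun U V x y => by
    rw [Ring.lie_def, smul_sub, ← smul_mul_assoc, ← mul_smul_comm]
    noncomm_ring
  simp only [heisenberg, hsmul, ← hprod]
  simpa only [smul_neg] using! hexp

theorem hasDerivAt_heisenberg (H A : 𝔸) (s : ℝ) :
    HasDerivAt (fun r => heisenberg H r A) (Complex.I • ⁅H, heisenberg H s A⁆) s := by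
  simpa [lie_heisenberg_self, heisenberg_smul]
    using hasDerivAt_heisenberg_comp H (hasDerivAt_const s A)

theorem hasDerivAt_interactionPicture (K H A : 𝔸) (s : ℝ) :
    HasDerivAt (fun r => interactionPicture K H r A)
      (heisenberg (-K) s (Complex.I • ⁅H - K, heisenberg H s A⁆)) s := by
  refine (hasDerivAt_heisenberg_comp (-K) (hasDerivAt_heisenberg H A s)).congr_deriv ?_
  rw [← smul_add, ← add_lie, neg_add_eq_sub]

theorem hasDerivAt_lie_interactionPicture (K H A B : 𝔸) (s : ℝ) :
    HasDerivAt (fun r => ⁅A, interactionPicture K H r B⁆)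
      ⁅A, heisenberg (-K) s (Complex.I • ⁅H - K, heisenberg H s B⁆)⁆ s :=
  ((hasDerivAt_interactionPicture K H B s).const_mul A).sub
    ((hasDerivAt_interactionPicture K H B s).mul_const A)

end BanachAlgebra

section CStarAlgebra

variable {𝔸 : Type*} [CStarAlgebra 𝔸]

theorem exp_I_smul_mem_unitary {H : 𝔸} (hH : IsSelfAdjoint H) (t : ℝ) :
    NormedSpace.exp ((Complex.I * (t : ℂ)) • H) ∈ unitary 𝔸 := by
  have htH : IsSelfAdjoint (t • H) := (IsSelfAdjoint.all t).smul hH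
  simpa only [selfAdjoint.expUnitary_coe, mul_smul, Complex.coe_smul]
    using (selfAdjoint.expUnitary ⟨t • H, htH⟩).2

theorem norm_heisenberg {H : 𝔸} (hH : IsSelfAdjoint H) (t : ℝ) (A : 𝔸) :
    ‖heisenberg H t A‖ = ‖A‖ := by
  have hneg : NormedSpace.exp (-((Complex.I * (t : ℂ)) • H)) ∈ unitary 𝔸 := by
    simpa using exp_I_smul_mem_unitary hH (-t)
  rw [heisenberg, CStarRing.norm_mul_mem_unitary _ hneg,
    CStarRing.norm_mem_unitary_mul _ (exp_I_smul_mem_unitary hH t)]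

theorem norm_deriv_interactionPicture {K : 𝔸} (hK : IsSelfAdjoint K) (H A : 𝔸) (s : ℝ) :
    ‖heisenberg (-K) s (Complex.I • ⁅H - K, heisenberg H s A⁆)‖ =
      ‖⁅H - K, heisenberg H s A⁆‖ := by
  rw [norm_heisenberg hK.neg, norm_smul, Complex.norm_I, one_mul]

theorem norm_heisenberg_sub_heisenberg_le {H K A : 𝔸} (hK : IsSelfAdjoint K) {c t : ℝ}
    (hc : ∀ s ∈ Set.uIcc 0 t, ‖⁅H - K, heisenberg H s A⁆‖ ≤ c) :
    ‖heisenberg H t A - heisenberg K t A‖ ≤ c * |t| := by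
  have hmvt := (convex_uIcc (0 : ℝ) t).norm_image_sub_le_of_norm_hasDerivWithin_le
    (fun s _ => (hasDerivAt_interactionPicture K H A s).hasDerivWithinAt)
    (fun s hs => (norm_deriv_interactionPicture hK H A s).trans_le (hc s hs))
    Set.left_mem_uIcc Set.right_mem_uIcc
  calc ‖heisenberg H t A - heisenberg K t A‖
      = ‖interactionPicture K H t A - interactionPicture K H 0 A‖ := by
        rw [← norm_heisenberg hK.neg t, heisenberg_sub, heisenberg_neg_heisenberg,
          interactionPicture_zero_time, interactionPicture]
    _ ≤ c * |t| := by simpa using hmvt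

theorem norm_heisenberg_sub_le {H : 𝔸} (hH : IsSelfAdjoint H) (A : 𝔸) (s t : ℝ) :
    ‖heisenberg H t A - heisenberg H s A‖ ≤ ‖⁅H, A⁆‖ * |t - s| :=
  convex_univ.norm_image_sub_le_of_norm_hasDerivWithin_le
    (fun r _ => (hasDerivAt_heisenberg H A r).hasDerivWithinAt)
    (fun r _ => by
      rw [norm_smul, Complex.norm_I, one_mul, lie_heisenberg_self, norm_heisenberg hH])
    (Set.mem_univ s) (Set.mem_univ t)

theorem norm_lie_interactionPicture {K A : 𝔸} (hK : IsSelfAdjoint K) (hA : ⁅A, K⁆ = 0)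
    (H B : 𝔸) (t : ℝ) : ‖⁅A, interactionPicture K H t B⁆‖ = ‖⁅A, heisenberg H t B⁆‖ := by
  have hfix : heisenberg (-K) t A = A :=
    heisenberg_eq_self_of_lie_eq_zero (by rw [lie_neg, hA, neg_zero]) t
  conv_lhs => rw [interactionPicture, ← hfix, ← heisenberg_lie]
  exact norm_heisenberg hK.neg t _

end CStarAlgebra

end Heisenberg

section Gronwall

variable {ι E : Type*} [Finite ι] [NormedAddCommGroup E] [NormedSpace ℝ E] {μ : ι → ℝ} {K D : ℝ}
  {g g' : ℝ → ι → E}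

theorem norm_le_exp_mul_of_weighted_norm_deriv_le_of_nonneg
    (hμ : ∀ i, 0 < μ i)
    (hg : ∀ s i, HasDerivAt (fun r => g r i) (g' s i) s)
    (hg' : ∀ s c, (∀ i, ‖g s i‖ ≤ c * μ i) → ∀ i, ‖g' s i‖ ≤ K * c * μ i)
    (hg₀ : ∀ i, ‖g 0 i‖ ≤ D * μ i) {t : ℝ} (ht : 0 ≤ t) (i : ι) :
    ‖g t i‖ ≤ D * Real.exp (K * t) * μ i := by
  have : Nonempty ι := ⟨i⟩
  cases nonempty_fintype ι
  let G : ℝ → ι → E := fun s i => (μ i)⁻¹ • g s i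
  let G' : ℝ → ι → E := fun s i => (μ i)⁻¹ • g' s i
  have hnorm : ∀ (x : E) c i, ‖(μ i)⁻¹ • x‖ ≤ c ↔ ‖x‖ ≤ c * μ i := fun x c i => by
    rw [norm_smul, norm_inv, Real.norm_of_nonneg (hμ i).le, inv_mul_le_iff₀ (hμ i), mul_comm]
  have hG_le : ∀ s c, ‖G s‖ ≤ c ↔ ∀ i, ‖g s i‖ ≤ c * μ i := fun s c =>
    (pi_norm_le_iff_of_nonempty _).trans (forall_congr' fun i => hnorm _ c i)
  have hG : ∀ s, HasDerivAt G (G' s) s := fun s => hasDerivAt_pi.2 fun i => (hg s i).const_smul _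
  have hG' : ∀ s, ‖G' s‖ ≤ K * ‖G s‖ + 0 := fun s => by
    rw [add_zero]
    exact (pi_norm_le_iff_of_nonempty _).2 fun i =>
      (hnorm _ _ i).2 (hg' s _ ((hG_le s _).1 le_rfl) i)
  have hgronwall := norm_le_gronwallBound_of_norm_deriv_right_le
    (fun s _ => (hG s).continuousAt.continuousWithinAt) (fun s _ => (hG s).hasDerivWithinAt)
    ((hG_le 0 D).2 hg₀) (fun s _ => hG' s) t (Set.right_mem_Icc.2 ht)
  rw [gronwallBound_ε0, sub_zero] at hgronwall
  exact (hG_le t _).1 hgronwall i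

theorem norm_le_exp_mul_of_weighted_norm_deriv_le (hμ : ∀ i, 0 < μ i)
    (hg : ∀ s i, HasDerivAt (fun r => g r i) (g' s i) s)
    (hg' : ∀ s c, (∀ i, ‖g s i‖ ≤ c * μ i) → ∀ i, ‖g' s i‖ ≤ K * c * μ i)
    (hg₀ : ∀ i, ‖g 0 i‖ ≤ D * μ i) (t : ℝ) (i : ι) :
    ‖g t i‖ ≤ D * Real.exp (K * |t|) * μ i := by
  obtain ht | ht := le_total 0 t
  · rw [abs_of_nonneg ht]
    exact norm_le_exp_mul_of_weighted_norm_deriv_le_of_nonneg hμ hg hg' hg₀ ht i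
  · rw [abs_of_nonpos ht]
    have hrev := norm_le_exp_mul_of_weighted_norm_deriv_le_of_nonneg (g := fun s => g (-s))
      (g' := fun s i => -g' (-s) i) hμ
      (fun s i => by simpa using! (hg (-s) i).scomp s (hasDerivAt_neg s))
      (fun s c hc i => by simpa only [norm_neg] using hg' (-s) c hc i)
      (by simpa only [neg_zero] using hg₀) (neg_nonneg.2 ht) i
    simpa only [neg_neg] using hrev

end Gronwall

section LiebRobinson

attribute [local instance] LieRing.ofAssociativeRing

variable {ι 𝔸 : Type*} [CStarAlgebra 𝔸] {h : ι → 𝔸} {μ : ι → ℝ} {K D M : ℝ} {B : 𝔸}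

open Classical in
/-- The sum of the terms `h j`, `j ∈ V`, that commute with `A`. -/
def commutingPart (h : ι → 𝔸) (V : Finset ι) (A : 𝔸) : 𝔸 := ∑ j ∈ V with ⁅A, h j⁆ = 0, h j

theorem isSelfAdjoint_commutingPart (hh : ∀ i, IsSelfAdjoint (h i)) (V : Finset ι) (A : 𝔸) :
    IsSelfAdjoint (commutingPart h V A) :=
  isSelfAdjoint_sum _ fun j _ => hh j

theorem lie_commutingPart (h : ι → 𝔸) (V : Finset ι) (A : 𝔸) : ⁅A, commutingPart h V A⁆ = 0 := by
  classical
  rw [commutingPart, lie_sum]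
  exact Finset.sum_eq_zero fun j hj => (Finset.mem_filter.1 hj).2

open Classical in
theorem sum_sub_commutingPart (h : ι → 𝔸) (V : Finset ι) (A : 𝔸) :
    ∑ j ∈ V, h j - commutingPart h V A = ∑ j ∈ V with ⁅A, h j⁆ ≠ 0, h j := by
  rw [sub_eq_iff_eq_add']
  exact (Finset.sum_filter_add_sum_filter_not V _ h).symm

open Classical in
theorem norm_deriv_lie_interactionPicture_le (hh : ∀ i, IsSelfAdjoint (h i)) (V : Finset ι)
    (A B : 𝔸) (s : ℝ) :
    ‖⁅A, heisenberg (-commutingPart h V A) s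
        (Complex.I • ⁅∑ j ∈ V, h j - commutingPart h V A, heisenberg (∑ j ∈ V, h j) s B⁆)⁆‖ ≤
      2 * ‖A‖ * ∑ j ∈ V with ⁅A, h j⁆ ≠ 0, ‖⁅h j, heisenberg (∑ j ∈ V, h j) s B⁆‖ := by
  refine (norm_lie_le _ _).trans ?_
  rw [norm_deriv_interactionPicture (isSelfAdjoint_commutingPart hh V A), sum_sub_commutingPart,
    sum_lie]
  gcongr
  exact norm_sum_le _ _

open Classical in
/-- A weight `μ` on the index set of the interaction `h` which the couplings of `h` enlarge at most
by the factor `K`. Only the terms `h j` that do not commute with `h i` make `⁅h i, B⁆` grow, at a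
rate controlled by the `⁅h j, B⁆`; hence a bound of all `‖⁅h i, B⁆‖` by a multiple of `μ i`
propagates in time with the exponential rate `K`. -/
structure IsGrowthWeight (h : ι → 𝔸) (μ : ι → ℝ) (K : ℝ) : Prop where
  pos : ∀ i, 0 < μ i
  sum_le : ∀ i (V : Finset ι), 2 * ‖h i‖ * ∑ j ∈ V with ⁅h i, h j⁆ ≠ 0, μ j ≤ K * μ i

theorem IsGrowthWeight.nonneg [Nonempty ι] (hμ : IsGrowthWeight h μ K) : 0 ≤ K := by
  obtain ⟨i⟩ := ‹Nonempty ι›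
  have hi := hμ.sum_le i ∅
  simp only [Finset.filter_empty, Finset.sum_empty, mul_zero] at hi
  exact nonneg_of_mul_nonneg_left hi (hμ.pos i)

theorem IsGrowthWeight.nonneg_of_norm_lie_le [Nonempty ι] (hμ : IsGrowthWeight h μ K)
    (hB : ∀ i, ‖⁅h i, B⁆‖ ≤ D * μ i) : 0 ≤ D := by
  obtain ⟨i⟩ := ‹Nonempty ι›
  exact nonneg_of_mul_nonneg_left ((norm_nonneg _).trans (hB i)) (hμ.pos i)

theorem IsGrowthWeight.norm_lie_heisenberg_le (hμ : IsGrowthWeight h μ K)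
    (hh : ∀ i, IsSelfAdjoint (h i)) (hB : ∀ i, ‖⁅h i, B⁆‖ ≤ D * μ i) (V : Finset ι)
    (t : ℝ) (i : ι) :
    ‖⁅h i, heisenberg (∑ j ∈ V, h j) t B⁆‖ ≤ D * Real.exp (K * |t|) * μ i := by
  classical
  let H := ∑ j ∈ V, h j
  let W : Finset ι := insert i V
  let L : W → 𝔸 := fun k => commutingPart h V (h k)
  have hL_norm : ∀ s (k : W),
      ‖⁅h k, interactionPicture (L k) H s B⁆‖ = ‖⁅h k, heisenberg H s B⁆‖ := fun s k =>
    norm_lie_interactionPicture (isSelfAdjoint_commutingPart hh V _)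
      (lie_commutingPart h V _) H B s
  rw [← hL_norm t ⟨i, Finset.mem_insert_self i V⟩]
  refine norm_le_exp_mul_of_weighted_norm_deriv_le (μ := fun k : W => μ k)
    (g := fun s k => ⁅h k, interactionPicture (L k) H s B⁆) (fun k => hμ.pos k)
    (fun s k => hasDerivAt_lie_interactionPicture (L k) H (h k) B s) (fun s c hc k => ?_)
    (fun k => by simpa only [interactionPicture_zero_time] using hB k) t
    ⟨i, Finset.mem_insert_self i V⟩
  calc ‖⁅h k, heisenberg (-L k) s (Complex.I • ⁅H - L k, heisenberg H s B⁆)⁆‖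
      ≤ 2 * ‖h k‖ * ∑ j ∈ V with ⁅h k, h j⁆ ≠ 0, ‖⁅h j, heisenberg H s B⁆‖ :=
        norm_deriv_lie_interactionPicture_le hh V _ B s
    _ ≤ 2 * ‖h k‖ * ∑ j ∈ V with ⁅h k, h j⁆ ≠ 0, c * μ j := by
        gcongr with j hj
        have hjW : j ∈ W := Finset.mem_insert_of_mem (Finset.mem_filter.1 hj).1
        exact (hL_norm s ⟨j, hjW⟩).symm.trans_le (hc ⟨j, hjW⟩)
    _ = c * (2 * ‖h k‖ * ∑ j ∈ V with ⁅h k, h j⁆ ≠ 0, μ j) := by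
        rw [← Finset.mul_sum, mul_left_comm]
    _ ≤ c * (K * μ k) := by
        have hc_nonneg : 0 ≤ c :=
          nonneg_of_mul_nonneg_left ((norm_nonneg _).trans (hc k)) (hμ.pos k)
        exact mul_le_mul_of_nonneg_left (hμ.sum_le k V) hc_nonneg
    _ = K * c * μ k := by ring

open Classical in
theorem IsGrowthWeight.norm_lie_heisenberg_le_add [Nonempty ι] (hμ : IsGrowthWeight h μ K)
    (hh : ∀ i, IsSelfAdjoint (h i)) (hB : ∀ i, ‖⁅h i, B⁆‖ ≤ D * μ i) {V : Finset ι}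
    {A : 𝔸} (hA : ∑ j ∈ V with ⁅A, h j⁆ ≠ 0, μ j ≤ M) (t : ℝ) :
    ‖⁅A, heisenberg (∑ j ∈ V, h j) t B⁆‖ ≤
      ‖⁅A, B⁆‖ + 2 * ‖A‖ * (D * M) * (|t| * Real.exp (K * |t|)) := by
  have hK := hμ.nonneg
  have hD := hμ.nonneg_of_norm_lie_le hB
  let H := ∑ j ∈ V, h j
  let L := commutingPart h V A
  have hderiv_le : ∀ s ∈ Set.uIcc 0 t,
      ‖⁅A, heisenberg (-L) s (Complex.I • ⁅H - L, heisenberg H s B⁆)⁆‖ ≤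
        2 * ‖A‖ * (D * Real.exp (K * |t|) * M) := fun s hs => by
    have hst : |s| ≤ |t| := by simpa using Set.abs_sub_left_of_mem_uIcc hs
    calc _ ≤ 2 * ‖A‖ * ∑ j ∈ V with ⁅A, h j⁆ ≠ 0, ‖⁅h j, heisenberg H s B⁆‖ :=
          norm_deriv_lie_interactionPicture_le hh V A B s
      _ ≤ 2 * ‖A‖ * ∑ j ∈ V with ⁅A, h j⁆ ≠ 0, D * Real.exp (K * |t|) * μ j := by
          gcongr with j
          have := (hμ.pos j).le
          exact (hμ.norm_lie_heisenberg_le hh hB V s j).trans (by gcongr)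
      _ ≤ 2 * ‖A‖ * (D * Real.exp (K * |t|) * M) := by
          rw [← Finset.mul_sum]
          gcongr
  have hmvt := (convex_uIcc (0 : ℝ) t).norm_image_sub_le_of_norm_hasDerivWithin_le
    (fun s _ => (hasDerivAt_lie_interactionPicture L H A B s).hasDerivWithinAt) hderiv_le
    Set.left_mem_uIcc Set.right_mem_uIcc
  calc _ = ‖⁅A, interactionPicture L H t B⁆‖ :=
        (norm_lie_interactionPicture (isSelfAdjoint_commutingPart hh V A)
          (lie_commutingPart h V A) H B t).symm
    _ ≤ ‖⁅A, interactionPicture L H 0 B⁆‖ + 2 * ‖A‖ * (D * Real.exp (K * |t|) * M) * ‖t - 0‖ :=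
        norm_le_norm_add_norm_sub' _ _ |>.trans (by gcongr)
    _ = _ := by
        rw [interactionPicture_zero_time, sub_zero, Real.norm_eq_abs]
        ring

theorem IsGrowthWeight.norm_lie_sum_heisenberg_le (hμ : IsGrowthWeight h μ K)
    (hh : ∀ i, IsSelfAdjoint (h i)) (hB : ∀ i, ‖⁅h i, B⁆‖ ≤ D * μ i) (S V : Finset ι) (t : ℝ) :
    ‖⁅∑ i ∈ S, h i, heisenberg (∑ j ∈ V, h j) t B⁆‖ ≤
      D * Real.exp (K * |t|) * ∑ i ∈ S, μ i := by
  rw [sum_lie, Finset.mul_sum]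
  exact (norm_sum_le _ _).trans (Finset.sum_le_sum fun i _ => hμ.norm_lie_heisenberg_le hh hB V t i)

theorem IsGrowthWeight.norm_heisenberg_sub_heisenberg_le [Nonempty ι] (hμ : IsGrowthWeight h μ K)
    (hh : ∀ i, IsSelfAdjoint (h i)) (hB : ∀ i, ‖⁅h i, B⁆‖ ≤ D * μ i) {V W : Finset ι}
    (hVW : V ⊆ W) (t : ℝ) :
    ‖heisenberg (∑ j ∈ V, h j) t B - heisenberg (∑ j ∈ W, h j) t B‖ ≤
      D * Real.exp (K * |t|) * |t| * (∑ i ∈ W, μ i - ∑ i ∈ V, μ i) := by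
  classical
  have hK := hμ.nonneg
  have hD := hμ.nonneg_of_norm_lie_le hB
  rw [← Finset.sum_sdiff_eq_sub hVW, mul_right_comm]
  refine SpinLattice.norm_heisenberg_sub_heisenberg_le (isSelfAdjoint_sum _ fun j _ => hh j)
    fun s hs => ?_
  have hst : |s| ≤ |t| := by simpa using Set.abs_sub_left_of_mem_uIcc hs
  rw [← neg_sub, ← Finset.sum_sdiff_eq_sub hVW, neg_lie, norm_neg]
  have hμ_nonneg : 0 ≤ ∑ i ∈ W \ V, μ i := Finset.sum_nonneg fun i _ => (hμ.pos i).le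
  exact (hμ.norm_lie_sum_heisenberg_le hh hB _ V s).trans (by gcongr)

theorem IsGrowthWeight.cauchySeq_heisenberg [Nonempty ι] (hμ : IsGrowthWeight h μ K)
    (hsum : Summable μ) (hh : ∀ i, IsSelfAdjoint (h i)) (hB : ∀ i, ‖⁅h i, B⁆‖ ≤ D * μ i) (t : ℝ) :
    CauchySeq fun V : Finset ι => heisenberg (∑ j ∈ V, h j) t B := by
  classical
  have hD := hμ.nonneg_of_norm_lie_le hB
  refine cauchySeq_of_le_tendsto_0'
    (fun V => D * Real.exp (K * |t|) * |t| * (∑' i, μ i - ∑ i ∈ V, μ i)) (fun V W hVW => ?_) ?_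
  · rw [dist_eq_norm]
    refine (hμ.norm_heisenberg_sub_heisenberg_le hh hB hVW t).trans ?_
    gcongr
    exact hsum.sum_le_tsum W fun i _ => (hμ.pos i).le
  · simpa using ((tendsto_const_nhds (x := ∑' i, μ i)).sub hsum.hasSum).const_mul
      (D * Real.exp (K * |t|) * |t|)

theorem IsGrowthWeight.norm_heisenberg_sub_le [Nonempty ι] (hμ : IsGrowthWeight h μ K)
    (hsum : Summable μ) (hh : ∀ i, IsSelfAdjoint (h i)) (hB : ∀ i, ‖⁅h i, B⁆‖ ≤ D * μ i)
    (V : Finset ι) (s t : ℝ) :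
    ‖heisenberg (∑ j ∈ V, h j) t B - heisenberg (∑ j ∈ V, h j) s B‖ ≤
      D * (∑' i, μ i) * |t - s| := by
  have hD := hμ.nonneg_of_norm_lie_le hB
  refine (SpinLattice.norm_heisenberg_sub_le (isSelfAdjoint_sum _ fun j _ => hh j) B s t).trans ?_
  gcongr
  calc ‖⁅∑ j ∈ V, h j, B⁆‖ ≤ D * ∑ i ∈ V, μ i := by
        simpa using hμ.norm_lie_sum_heisenberg_le hh hB V ∅ 0
    _ ≤ D * ∑' i, μ i := by
        gcongr
        exact hsum.sum_le_tsum V fun i _ => (hμ.pos i).le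

end LiebRobinson

section Support

variable {d : ℕ} {Λ : Submodule ℤ (Space d)} {q : ℕ} [NeZero q]

open Classical in
theorem ket_apply (τ σ : Config Λ q) : ket τ σ = if σ = τ then 1 else 0 := by
  rw [ket, lp.single_apply, Pi.single_apply]

theorem hasSum_smul_ket (ψ : HilbertSp Λ q) : HasSum (fun τ => ψ τ • ket τ) ψ := by
  classical
  have hket : ∀ τ, ψ τ • ket τ = lp.single 2 τ (ψ τ) := fun τ => by
    rw [ket, ← lp.single_smul, smul_eq_mul, mul_one]
  simpa only [hket] using lp.hasSum_single (p := 2) (by norm_num) ψ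

theorem op_ext {A B : Op Λ q} (h : ∀ σ τ, matrixElement A σ τ = matrixElement B σ τ) :
    A = B := by
  have hket : ∀ τ, A (ket τ) = B (ket τ) := fun τ => by
    ext σ
    exact h σ τ
  ext1 ψ
  refine ((hasSum_smul_ket ψ).mapL A).unique ?_
  simpa only [map_smul, hket] using (hasSum_smul_ket ψ).mapL B

theorem hasSum_matrixElement_mul (A B : Op Λ q) (σ τ : Config Λ q) :
    HasSum (fun ρ => matrixElement A σ ρ * matrixElement B ρ τ) (matrixElement (A * B) σ τ) := by
  have hsum := ((hasSum_smul_ket (B (ket τ))).mapL A).mapL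
    (lp.evalCLM ℂ (fun _ : Config Λ q => ℂ) 2 σ)
  simpa only [map_smul, smul_eq_mul, mul_comm (matrixElement A σ _)] using! hsum

open Classical in
/-- The configuration which agrees with `σ` on `S` and with `τ` elsewhere. It is the only
intermediate state in a product of operators with disjoint supports. -/
def splice (S : Set Λ) (σ τ : Config Λ q) : Config Λ q :=
  Finsupp.onFinset (σ.support ∪ τ.support) (S.piecewise σ τ) fun x hx => by
    by_cases hS : x ∈ S <;> simp_all

theorem splice_of_mem {S : Set Λ} (σ τ : Config Λ q) {x : Λ} (hx : x ∈ S) :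
    splice S σ τ x = σ x := by simp [splice, hx]

theorem splice_of_notMem {S : Set Λ} (σ τ : Config Λ q) {x : Λ} (hx : x ∉ S) :
    splice S σ τ x = τ x := by simp [splice, hx]

theorem IsSupportedOn.eq_of_matrixElement_ne_zero {S : Set Λ} {A : Op Λ q}
    (hA : IsSupportedOn S A) {σ τ : Config Λ q} (hne : matrixElement A σ τ ≠ 0) {x : Λ}
    (hx : x ∉ S) : σ x = τ x := by
  by_contra h
  exact hne (hA.1 σ τ ⟨x, hx, h⟩)

theorem matrixElement_mul_of_disjoint {S T : Set Λ} (hST : Disjoint S T) {A B : Op Λ q}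
    (hA : IsSupportedOn S A) (hB : IsSupportedOn T B) (σ τ : Config Λ q) :
    matrixElement (A * B) σ τ =
      matrixElement A σ (splice T σ τ) * matrixElement B (splice T σ τ) τ := by
  refine (hasSum_matrixElement_mul A B σ τ).unique (hasSum_single _ fun ρ hρ => ?_)
  contrapose! hρ
  obtain ⟨hAρ, hBρ⟩ := mul_ne_zero_iff.1 hρ
  ext1 x
  by_cases hx : x ∈ T
  · rw [splice_of_mem _ _ hx, hA.eq_of_matrixElement_ne_zero hAρ (hST.notMem_of_mem_right hx)]
  · rw [splice_of_notMem _ _ hx, hB.eq_of_matrixElement_ne_zero hBρ hx]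

theorem matrixElement_splice_eq {S T : Set Λ} (hST : Disjoint S T) {A : Op Λ q}
    (hA : IsSupportedOn S A) {σ τ : Config Λ q} (h : ∀ x, x ∉ S → x ∉ T → σ x = τ x) :
    matrixElement A σ (splice T σ τ) = matrixElement A (splice S σ τ) τ := by
  refine hA.2 _ _ _ _ (fun x hx => ?_) (fun x hx => splice_of_notMem _ _ hx)
    (fun x hx => (splice_of_mem _ _ hx).symm)
    fun x hx => splice_of_notMem _ _ (hST.notMem_of_mem_left hx)
  by_cases hT : x ∈ T
  · rw [splice_of_mem _ _ hT]
  · rw [splice_of_notMem _ _ hT, h x hx hT]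

theorem matrixElement_mul_eq_zero {S T : Set Λ} (hST : Disjoint S T) {A B : Op Λ q}
    (hA : IsSupportedOn S A) (hB : IsSupportedOn T B) {σ τ : Config Λ q} {x : Λ} (hxS : x ∉ S)
    (hxT : x ∉ T) (hne : σ x ≠ τ x) : matrixElement (A * B) σ τ = 0 := by
  rw [matrixElement_mul_of_disjoint hST hA hB,
    hA.1 σ _ ⟨x, hxS, by rwa [splice_of_notMem _ _ hxT]⟩, zero_mul]

theorem lie_eq_zero_of_disjoint {S T : Set Λ} (hST : Disjoint S T) {A B : Op Λ q}
    (hA : IsSupportedOn S A) (hB : IsSupportedOn T B) : ⁅A, B⁆ = 0 := by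
  rw [Ring.lie_def, sub_eq_zero]
  refine op_ext fun σ τ => ?_
  by_cases h : ∀ x, x ∉ S → x ∉ T → σ x = τ x
  · rw [matrixElement_mul_of_disjoint hST hA hB, matrixElement_mul_of_disjoint hST.symm hB hA,
      matrixElement_splice_eq hST hA h,
      matrixElement_splice_eq hST.symm hB fun x hT hS => h x hS hT, mul_comm]
  · push Not at h
    obtain ⟨x, hxS, hxT, hne⟩ := h
    rw [matrixElement_mul_eq_zero hST hA hB hxS hxT hne,
      matrixElement_mul_eq_zero hST.symm hB hA hxT hxS hne]

theorem IsSupportedOn.mono {S T : Set Λ} (hST : S ⊆ T) {A : Op Λ q} (hA : IsSupportedOn S A) :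
    IsSupportedOn T A := by
  refine ⟨fun σ τ ⟨x, hx, hne⟩ => hA.1 σ τ ⟨x, fun h => hx (hST h), hne⟩,
    fun σ τ σ' τ' hστ hστ' hσ hτ => ?_⟩
  by_cases h : ∀ x, x ∉ S → σ x = τ x
  · refine hA.2 σ τ σ' τ' h (fun x hx => ?_) (fun x hx => hσ x (hST hx)) fun x hx => hτ x (hST hx)
    by_cases hT : x ∈ T
    · rw [← hσ x hT, ← hτ x hT, h x hx]
    · exact hστ' x hT
  · push Not at h
    obtain ⟨x, hx, hne⟩ := h
    have hT : x ∈ T := not_imp_comm.1 (hστ x) hne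
    rw [hA.1 σ τ ⟨x, hx, hne⟩, hA.1 σ' τ' ⟨x, hx, by rwa [← hσ x hT, ← hτ x hT]⟩]

theorem IsLocal.exists_isSupportedOn_closedBall {A : Op Λ q} (hA : IsLocal A) :
    ∃ r : ℝ, IsSupportedOn (Metric.closedBall 0 r) A := by
  obtain ⟨S, hS⟩ := hA
  obtain ⟨r, hr⟩ := S.finite_toSet.isBounded.subset_closedBall (0 : Λ)
  exact ⟨r, hS.mono hr⟩

theorem Hamiltonian.isSupportedOn_term (H : Hamiltonian Λ q) (z : Λ) :
    IsSupportedOn (Metric.closedBall z H.range) (H.term z) :=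
  (H.supported z).mono Metric.ball_subset_closedBall

theorem shiftConfig_apply (y : Λ) (σ : Config Λ q) (x : Λ) : shiftConfig y σ x = σ (x + y) := rfl

theorem translation_symm_ket (y : Λ) (τ : Config Λ q) :
    (translation y).symm (ket τ) = ket (shiftConfig y τ) := by
  rw [LinearIsometryEquiv.symm_apply_eq]
  ext σ
  change ket τ σ = ket (shiftConfig y τ) (shiftConfig y σ)
  simp only [ket_apply, EmbeddingLike.apply_eq_iff_eq]

theorem matrixElement_translate (y : Λ) (A : Op Λ q) (σ τ : Config Λ q) :
    matrixElement (translate y A) σ τ = matrixElement A (shiftConfig y σ) (shiftConfig y τ) := by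
  change (translation y (A ((translation y).symm (ket τ)))) σ = _
  rw [translation_symm_ket]
  rfl

theorem IsSupportedOn.translate {S : Set Λ} {A : Op Λ q} (hA : IsSupportedOn S A) (y : Λ) :
    IsSupportedOn ((· - y) ⁻¹' S) (translate y A) := by
  refine ⟨fun σ τ ⟨x, hx, hne⟩ => ?_, fun σ τ σ' τ' hστ hστ' hσ hτ => ?_⟩
  · rw [matrixElement_translate]
    exact hA.1 _ _ ⟨x - y, hx, by simpa [shiftConfig_apply] using hne⟩
  · rw [matrixElement_translate, matrixElement_translate]
    have hmem : ∀ x, x + y ∈ (· - y) ⁻¹' S ↔ x ∈ S := fun x => by simp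
    exact hA.2 _ _ _ _ (fun x hx => hστ _ (mt (hmem x).1 hx))
      (fun x hx => hστ' _ (mt (hmem x).1 hx)) (fun x hx => hσ _ ((hmem x).2 hx))
      fun x hx => hτ _ ((hmem x).2 hx)

theorem IsSupportedOn.translate_closedBall {A : Op Λ q} {r : ℝ}
    (hA : IsSupportedOn (Metric.closedBall 0 r) A) (y : Λ) :
    IsSupportedOn (Metric.closedBall y r) (SpinLattice.translate y A) :=
  (hA.translate y).mono fun x hx => by simpa [dist_eq_norm] using hx

theorem norm_translate_le (y : Λ) (A : Op Λ q) : ‖translate y A‖ ≤ ‖A‖ := by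
  refine ContinuousLinearMap.opNorm_le_bound _ (norm_nonneg _) fun ψ => ?_
  calc ‖translate y A ψ‖ = ‖translation y (A ((translation y).symm ψ))‖ := rfl
    _ ≤ ‖A‖ * ‖ψ‖ := by simpa using A.le_opNorm ((translation y).symm ψ)

theorem norm_lie_le_exp_mul_exp_neg_norm {A B : Op Λ q} {y : Λ} {a r : ℝ}
    (hA : IsSupportedOn (Metric.closedBall y a) A)
    (hB : IsSupportedOn (Metric.closedBall 0 r) B) :
    ‖⁅A, B⁆‖ ≤ 2 * ‖A‖ * ‖B‖ * Real.exp (a + r) * Real.exp (-‖y‖) := by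
  obtain hy | hy := le_or_gt ‖y‖ (a + r)
  · refine (norm_lie_le A B).trans ?_
    rw [mul_assoc (2 * ‖A‖ * ‖B‖), ← Real.exp_add]
    exact le_mul_of_one_le_right (by positivity) (Real.one_le_exp (by linarith))
  · rw [lie_eq_zero_of_disjoint (Metric.closedBall_disjoint_closedBall (by simpa using hy)) hA hB,
      norm_zero]
    positivity

end Support

section ExponentialWeight

theorem sum_exp_neg_norm_le {E : Type*} [SeminormedAddCommGroup E]
    (hsum : Summable fun w : E => Real.exp (-‖w‖)) {z : E} {ρ : ℝ} {S : Finset E}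
    (hS : ∀ w ∈ S, dist z w ≤ ρ) :
    ∑ w ∈ S, Real.exp (-‖w‖) ≤
      Real.exp (2 * ρ) * (∑' w : E, Real.exp (-‖w‖)) * Real.exp (-‖z‖) := by
  have hshift : Summable fun w : E => Real.exp (-‖w - z‖) :=
    hsum.comp_injective (Equiv.subRight z).injective
  have htsum : ∑' w : E, Real.exp (-‖w - z‖) = ∑' w : E, Real.exp (-‖w‖) :=
    (Equiv.subRight z).tsum_eq fun w : E => Real.exp (-‖w‖)
  calc ∑ w ∈ S, Real.exp (-‖w‖)
      ≤ ∑ w ∈ S, Real.exp (2 * ρ) * Real.exp (-‖z‖) * Real.exp (-‖w - z‖) := by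
        refine Finset.sum_le_sum fun w hw => ?_
        have hzw : ‖w - z‖ ≤ ρ := by simpa only [dist_comm z, dist_eq_norm] using hS w hw
        rw [← Real.exp_add, ← Real.exp_add, Real.exp_le_exp]
        linarith [norm_sub_norm_le z w, norm_sub_rev z w]
    _ = Real.exp (2 * ρ) * Real.exp (-‖z‖) * ∑ w ∈ S, Real.exp (-‖w - z‖) := by
        rw [Finset.mul_sum]
    _ ≤ Real.exp (2 * ρ) * Real.exp (-‖z‖) * ∑' w : E, Real.exp (-‖w - z‖) := by
        gcongr
        exact hshift.sum_le_tsum S fun _ _ => (Real.exp_pos _).le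
    _ = Real.exp (2 * ρ) * (∑' w : E, Real.exp (-‖w‖)) * Real.exp (-‖z‖) := by
        rw [htsum, mul_right_comm]

theorem summable_exp_neg_norm {E : Type*} [NormedAddCommGroup E] [NormedSpace ℝ E]
    [FiniteDimensional ℝ E] (L : Submodule ℤ E) [DiscreteTopology L] :
    Summable fun z : L => Real.exp (-‖z‖) := by
  let k := Module.finrank ℤ L + 1
  refine .of_norm_bounded_eventually
    ((ZLattice.summable_norm_pow_inv L k (Nat.lt_succ_self _)).mul_left (k.factorial : ℝ))
    ((Set.finite_singleton (0 : L)).subset fun z hz => ?_)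
  by_contra hz_ne
  refine hz ?_
  have : 0 < ‖z‖ ^ k := pow_pos (norm_pos_iff.2 hz_ne) k
  calc ‖Real.exp (-‖z‖)‖ = (Real.exp ‖z‖)⁻¹ := by
        rw [Real.norm_of_nonneg (Real.exp_pos _).le, Real.exp_neg]
    _ ≤ (‖z‖ ^ k / k.factorial)⁻¹ := by
        gcongr
        exact Real.pow_div_factorial_le_exp ‖z‖ (norm_nonneg z) k
    _ = k.factorial * ‖z‖⁻¹ ^ k := by rw [inv_div, div_eq_mul_inv, inv_pow]

end ExponentialWeight

section Lattice

variable {d : ℕ} {Λ : Submodule ℤ (Space d)} {q : ℕ} [NeZero q] (H : Hamiltonian Λ q)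
  {A B : Op Λ q}

theorem Hamiltonian.evolveIn_eq_heisenberg (V : Finset Λ) (t : ℝ) (A : Op Λ q) :
    H.evolveIn V t A = heisenberg (∑ z ∈ V, H.term z) t A := rfl

theorem Hamiltonian.commutator_eq_lie (t : ℝ) (y : Λ) (A B : Op Λ q) :
    H.commutator A B t y = ⁅H.evolve t A, translate y B⁆ := rfl

theorem Hamiltonian.exists_norm_lie_term_le (hB : IsLocal B) :
    ∃ D, ∀ z, ‖⁅H.term z, B⁆‖ ≤ D * Real.exp (-‖z‖) := by
  obtain ⟨r, hr⟩ := hB.exists_isSupportedOn_closedBall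
  obtain ⟨J, hJ⟩ := H.bounded
  refine ⟨2 * J * ‖B‖ * Real.exp (H.range + r), fun z => ?_⟩
  refine (norm_lie_le_exp_mul_exp_neg_norm (H.isSupportedOn_term z) hr).trans ?_
  gcongr
  exact hJ z

theorem exists_norm_lie_translate_le (hA : IsLocal A) (hB : IsLocal B) :
    ∃ C, 0 ≤ C ∧ ∀ y, ‖⁅translate y B, A⁆‖ ≤ C * Real.exp (-‖y‖) := by
  obtain ⟨a, ha⟩ := hA.exists_isSupportedOn_closedBall
  obtain ⟨r, hr⟩ := hB.exists_isSupportedOn_closedBall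
  refine ⟨2 * ‖B‖ * ‖A‖ * Real.exp (r + a), by positivity, fun y => ?_⟩
  refine (norm_lie_le_exp_mul_exp_neg_norm (hr.translate_closedBall y) ha).trans ?_
  gcongr
  exact norm_translate_le y B

variable [DiscreteTopology Λ]

open Classical in
theorem Hamiltonian.exists_sum_exp_neg_norm_le (r : ℝ) :
    ∃ N, ∀ (y : Λ) (A : Op Λ q), IsSupportedOn (Metric.closedBall y r) A → ∀ V : Finset Λ,
      ∑ w ∈ V with ⁅A, H.term w⁆ ≠ 0, Real.exp (-‖w‖) ≤ N * Real.exp (-‖y‖) := by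
  refine ⟨_, fun y A hA V => sum_exp_neg_norm_le (summable_exp_neg_norm Λ) (ρ := r + H.range)
    fun w hw => ?_⟩
  contrapose! hw
  simp [lie_eq_zero_of_disjoint (Metric.closedBall_disjoint_closedBall hw) hA
    (H.isSupportedOn_term w)]

theorem Hamiltonian.exists_isGrowthWeight :
    ∃ K, IsGrowthWeight H.term (fun z => Real.exp (-‖z‖)) K := by
  obtain ⟨J, hJ⟩ := H.bounded
  obtain ⟨N, hN⟩ := H.exists_sum_exp_neg_norm_le H.range
  refine ⟨2 * J * N, fun _ => Real.exp_pos _, fun z V => ?_⟩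
  rw [mul_assoc (2 * J)]
  have hJ_nonneg : 0 ≤ J := (norm_nonneg _).trans (hJ z)
  gcongr
  · exact hJ z
  · exact hN z _ (H.isSupportedOn_term z) V

theorem Hamiltonian.tendsto_evolveIn (hA : IsLocal A) (t : ℝ) :
    Tendsto (fun V : Finset Λ => H.evolveIn V t A) atTop (𝓝 (H.evolve t A)) := by
  obtain ⟨K, hK⟩ := H.exists_isGrowthWeight
  obtain ⟨D, hD⟩ := H.exists_norm_lie_term_le hA
  exact (hK.cauchySeq_heisenberg (summable_exp_neg_norm Λ) H.selfAdjoint hD t).tendsto_limUnder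

theorem Hamiltonian.norm_evolve (hA : IsLocal A) (t : ℝ) : ‖H.evolve t A‖ = ‖A‖ := by
  refine tendsto_nhds_unique (H.tendsto_evolveIn hA t).norm ?_
  simp only [H.evolveIn_eq_heisenberg,
    norm_heisenberg (isSelfAdjoint_sum _ fun z _ => H.selfAdjoint z), tendsto_const_nhds]

theorem Hamiltonian.continuous_evolve (hA : IsLocal A) : Continuous fun t => H.evolve t A := by
  obtain ⟨K, hK⟩ := H.exists_isGrowthWeight
  obtain ⟨D, hD⟩ := H.exists_norm_lie_term_le hA
  refine (LipschitzWith.of_dist_le' (K := D * ∑' z : Λ, Real.exp (-‖z‖)) fun t s => ?_).continuous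
  rw [dist_eq_norm, Real.dist_eq]
  exact le_of_tendsto' ((H.tendsto_evolveIn hA t).sub (H.tendsto_evolveIn hA s)).norm fun V =>
    hK.norm_heisenberg_sub_le (summable_exp_neg_norm Λ) H.selfAdjoint hD V s t

theorem Hamiltonian.continuous_commutator (hA : IsLocal A) (B : Op Λ q) (y : Λ) :
    Continuous fun t => H.commutator A B t y :=
  ((H.continuous_evolve hA).mul continuous_const).sub
    (continuous_const.mul (H.continuous_evolve hA))

theorem Hamiltonian.norm_commutator_le (hA : IsLocal A) (B : Op Λ q) (t : ℝ) (y : Λ) :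
    ‖H.commutator A B t y‖ ≤ 2 * ‖A‖ * ‖B‖ := by
  rw [H.commutator_eq_lie]
  refine (norm_lie_le _ _).trans ?_
  rw [H.norm_evolve hA]
  gcongr
  exact norm_translate_le y B

theorem Hamiltonian.norm_commutator_le_of_forall (hA : IsLocal A) {t c : ℝ} {y : Λ}
    (h : ∀ V, ‖⁅translate y B, H.evolveIn V t A⁆‖ ≤ c) : ‖H.commutator A B t y‖ ≤ c := by
  rw [H.commutator_eq_lie, norm_lie_comm]
  exact le_of_tendsto' (((H.tendsto_evolveIn hA t).const_mul _).sub
    ((H.tendsto_evolveIn hA t).mul_const _)).norm h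

theorem Hamiltonian.exists_norm_commutator_le (hA : IsLocal A) (hB : IsLocal B) :
    ∃ C v : ℝ, 0 < v ∧ ∀ t y, ‖H.commutator A B t y‖ ≤ C * Real.exp (v * |t| - ‖y‖) := by
  obtain ⟨K, hK⟩ := H.exists_isGrowthWeight
  obtain ⟨D, hD⟩ := H.exists_norm_lie_term_le hA
  obtain ⟨C₀, hC₀, hAB⟩ := exists_norm_lie_translate_le hA hB
  obtain ⟨r, hr⟩ := hB.exists_isSupportedOn_closedBall
  obtain ⟨N, hN⟩ := H.exists_sum_exp_neg_norm_le r
  have hK_nonneg := hK.nonneg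
  have hD_nonneg := hK.nonneg_of_norm_lie_le hD
  have hN_nonneg : 0 ≤ N := by
    simpa using hN 0 B hr ∅
  refine ⟨C₀ + 2 * ‖B‖ * (D * N), K + 1, by positivity,
    fun t y => H.norm_commutator_le_of_forall hA fun V => ?_⟩
  have hgrowth : |t| * Real.exp (K * |t|) ≤ Real.exp ((K + 1) * |t|) := by
    rw [add_mul, one_mul, add_comm, Real.exp_add]
    gcongr
    linarith [Real.add_one_le_exp |t|]
  have hone : 1 ≤ Real.exp ((K + 1) * |t|) := Real.one_le_exp (by positivity)
  calc ‖⁅translate y B, H.evolveIn V t A⁆‖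
      ≤ ‖⁅translate y B, A⁆‖ +
          2 * ‖translate y B‖ * (D * (N * Real.exp (-‖y‖))) * (|t| * Real.exp (K * |t|)) :=
        hK.norm_lie_heisenberg_le_add H.selfAdjoint hD
          (hN y _ (hr.translate_closedBall y) V) t
    _ ≤ C₀ * Real.exp (-‖y‖) * Real.exp ((K + 1) * |t|) +
          2 * ‖B‖ * (D * (N * Real.exp (-‖y‖))) * Real.exp ((K + 1) * |t|) := by
        gcongr
        · exact (hAB y).trans (le_mul_of_one_le_right (by positivity) hone)
        · exact norm_translate_le y B
    _ = (C₀ + 2 * ‖B‖ * (D * N)) * Real.exp ((K + 1) * |t| - ‖y‖) := by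
        rw [sub_eq_neg_add, Real.exp_add]
        ring

end Lattice

section Rates

variable {E : Type*} [SeminormedAddCommGroup E]

/-- The growth rate `t⁻¹ ln ‖f (v t) t‖` at time `t` of a space-time field `f x t` along the ray
`x = v t`, with `ln 0 = -∞`. -/
def rayRate (f : ℝ → ℝ → E) (v t : ℝ) : EReal :=
  ((t⁻¹ : ℝ) : EReal) * ENNReal.log ‖f (v * t) t‖ₑ

/-- The times, tending to `∞`, at which the ray `x = v t` passes through `X`. -/
def rayTimes (X : Set ℝ) (v : ℝ) : Filter ℝ := atTop ⊓ 𝓟 {t | v * t ∈ X}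

/-- The rates `a` and `b` in `[-∞, ∞)` are `ε`-close, where `[-∞, -1/ε]` is the neighbourhood of
`-∞` of size `ε`. -/
def RateClose (ε : ℝ) (a b : EReal) : Prop :=
  a ≤ max (b + (ε : EReal)) ((-1 / ε : ℝ) : EReal) ∧
    b ≤ max (a + (ε : EReal)) ((-1 / ε : ℝ) : EReal)

/-- The growth rate of `f` along the ray of velocity `v` converges to `lam v`, uniformly for
`v ∈ W`. -/
def HasUniformRate (f : ℝ → ℝ → E) (X W : Set ℝ) (lam : ℝ → EReal) : Prop :=
  ∀ ε : ℝ, 0 < ε → ∃ T : ℝ, 0 < T ∧ ∀ t : ℝ, T ≤ t → ∀ v ∈ W, v * t ∈ X →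
    RateClose ε (rayRate f v t) (lam v)

variable {f : ℝ → ℝ → E} {X W : Set ℝ} {lam : ℝ → EReal}

theorem rayRate_le_iff {v t : ℝ} (ht : 0 < t) (a : ℝ) :
    rayRate f v t ≤ a ↔ ‖f (v * t) t‖ ≤ Real.exp (a * t) := by
  rw [rayRate, ← ofReal_norm]
  obtain h | h := (norm_nonneg (f (v * t) t)).eq_or_lt
  · simp [← h, EReal.coe_mul_bot_of_pos (inv_pos.2 ht), (Real.exp_pos _).le]
  · rw [ENNReal.log_ofReal_of_pos h, ← EReal.coe_mul, EReal.coe_le_coe_iff,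
      ← Real.log_le_iff_le_exp h, inv_mul_le_iff₀ ht, mul_comm t]

theorem rayTimes_neBot (hX : ¬ BddAbove X) {v : ℝ} (hv : 0 < v) : (rayTimes X v).NeBot := by
  rw [rayTimes, ← frequently_mem_iff_neBot, frequently_atTop]
  intro T
  obtain ⟨x, hx, hTx⟩ := not_bddAbove_iff.1 hX (v * T)
  exact ⟨x / v, ((lt_div_iff₀' hv).2 hTx).le, by rwa [Set.mem_ofPred, mul_div_cancel₀ _ hv.ne']⟩

theorem eventually_rayTimes {v : ℝ} {P : ℝ → Prop} :
    (∀ᶠ t in rayTimes X v, P t) ↔ ∀ᶠ t in atTop, v * t ∈ X → P t :=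
  eventually_inf_principal

theorem RateClose.symm {ε : ℝ} {a b : EReal} (h : RateClose ε a b) : RateClose ε b a :=
  And.symm h

theorem exists_rateClose_imp_le {x y : ℝ} (hxy : x < y) :
    ∃ ε : ℝ, 0 < ε ∧ ∀ a b, RateClose ε a b → a ≤ x → b ≤ y := by
  refine ⟨min (y - x) (|y| + 1)⁻¹, lt_min (sub_pos.2 hxy) (by positivity),
    fun a b h ha => h.2.trans (max_le ?_ ?_)⟩
  · calc a + ((min (y - x) (|y| + 1)⁻¹ : ℝ) : EReal) ≤ (x : EReal) + ((y - x : ℝ) : EReal) := by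
          gcongr
          exact min_le_left _ _
      _ = y := by rw [← EReal.coe_add, add_sub_cancel]
  · rw [EReal.coe_le_coe_iff]
    have hmin : 0 < min (y - x) (|y| + 1)⁻¹ := lt_min (sub_pos.2 hxy) (by positivity)
    calc -1 / min (y - x) (|y| + 1)⁻¹ ≤ -(|y| + 1) := by
          rw [neg_div, neg_le_neg_iff, one_div]
          exact (le_inv_comm₀ hmin (by positivity)).1 (min_le_right _ _)
      _ ≤ y := by linarith [neg_abs_le y]

theorem HasUniformRate.exists_rayRate_le (h : HasUniformRate f X W lam) {x y : ℝ} (hxy : x < y) :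
    ∃ T : ℝ, 0 < T ∧ ∀ t, T ≤ t → ∀ v ∈ W, v * t ∈ X → lam v ≤ x → rayRate f v t ≤ y := by
  obtain ⟨ε, hε, hclose⟩ := exists_rateClose_imp_le hxy
  obtain ⟨T, hT, hrate⟩ := h ε hε
  exact ⟨T, hT, fun t ht v hv hvX => hclose _ _ (hrate t ht v hv hvX).symm⟩

theorem HasUniformRate.exists_le_of_rayRate_le (h : HasUniformRate f X W lam) {x y : ℝ}
    (hxy : x < y) :
    ∃ T : ℝ, 0 < T ∧ ∀ t, T ≤ t → ∀ v ∈ W, v * t ∈ X → rayRate f v t ≤ x → lam v ≤ y := by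
  obtain ⟨ε, hε, hclose⟩ := exists_rateClose_imp_le hxy
  obtain ⟨T, hT, hrate⟩ := h ε hε
  exact ⟨T, hT, fun t ht v hv hvX => hclose _ _ (hrate t ht v hv hvX)⟩

theorem HasUniformRate.tendsto_rayRate (h : HasUniformRate f X W lam) {v : ℝ} (hv : v ∈ W) :
    Tendsto (rayRate f v) (rayTimes X v) (𝓝 (lam v)) := by
  refine tendsto_order.2 ⟨fun a ha => ?_, fun b hb => ?_⟩
  · obtain ⟨y, hay, hy⟩ := EReal.lt_iff_exists_real_btwn.1 ha
    obtain ⟨x, hax, hxy⟩ := EReal.lt_iff_exists_real_btwn.1 hay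
    obtain ⟨T, -, hT⟩ := h.exists_le_of_rayRate_le (EReal.coe_lt_coe_iff.1 hxy)
    rw [eventually_rayTimes]
    filter_upwards [eventually_ge_atTop T] with t ht htX
    exact hax.trans (lt_of_not_ge fun hle => (hT t ht v hv htX hle).not_gt hy)
  · obtain ⟨x, hx, hxb⟩ := EReal.lt_iff_exists_real_btwn.1 hb
    obtain ⟨y, hxy, hyb⟩ := EReal.lt_iff_exists_real_btwn.1 hxb
    obtain ⟨T, -, hT⟩ := h.exists_rayRate_le (EReal.coe_lt_coe_iff.1 hxy)
    rw [eventually_rayTimes]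
    filter_upwards [eventually_ge_atTop T] with t ht htX
    exact (hT t ht v hv htX hx.le).trans_lt hyb

theorem HasUniformRate.upperSemicontinuousOn (h : HasUniformRate f X W lam) (hX : ¬ BddAbove X)
    (hW : W ⊆ Set.Ioi 0) (hf : ∀ x ∈ X, ContinuousOn (f x) (Set.Ioi 0)) :
    UpperSemicontinuousOn lam W := by
  intro w hw y hy
  have hw₀ : 0 < w := hW hw
  obtain ⟨c₃, hc₃, hc₃y⟩ := EReal.lt_iff_exists_real_btwn.1 hy
  obtain ⟨c₀, hc₀, hc₀₃⟩ := EReal.lt_iff_exists_real_btwn.1 hc₃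
  obtain ⟨c₁, hc₀₁, hc₁₃⟩ := exists_between (EReal.coe_lt_coe_iff.1 hc₀₃)
  obtain ⟨c₂, hc₁₂, hc₂₃⟩ := exists_between hc₁₃
  obtain ⟨T, hT, hle⟩ := h.exists_rayRate_le hc₀₁
  obtain ⟨T', hT', hle'⟩ := h.exists_le_of_rayRate_le hc₂₃
  have := rayTimes_neBot hX hw₀
  have htimes : ∀ᶠ t in rayTimes X w, T ≤ t ∧ T' < t ∧ w * t ∈ X := by
    rw [eventually_rayTimes]
    filter_upwards [eventually_ge_atTop T, eventually_gt_atTop T'] with t htT htT' htX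
    exact ⟨htT, htT', htX⟩
  obtain ⟨t, htT, htT', htX⟩ := htimes.exists
  have ht₀ : 0 < t := hT.trans_le htT
  -- The ray of a nearby velocity `u` passes through the same point `w * t` at a time close to `t`.
  let τ : ℝ → ℝ := fun u => w * t / u
  have hτw : τ w = t := mul_div_cancel_left₀ _ hw₀.ne'
  have hτ : ContinuousAt τ w := continuousAt_const.div continuousAt_id hw₀.ne'
  have hnorm : ContinuousAt (fun u => ‖f (w * t) (τ u)‖) w :=
    (ContinuousAt.comp (by rw [hτw]; exact (hf _ htX).continuousAt (Ioi_mem_nhds ht₀)) hτ).norm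
  have hexp : ContinuousAt (fun u => Real.exp (c₂ * τ u)) w := (continuousAt_const.mul hτ).rexp
  have hlt : ‖f (w * t) (τ w)‖ < Real.exp (c₂ * τ w) := by
    rw [hτw]
    refine ((rayRate_le_iff ht₀ c₁).1 (hle t htT w hw htX hc₀.le)).trans_lt ?_
    gcongr
  filter_upwards [self_mem_nhdsWithin, mem_nhdsWithin_of_mem_nhds (hnorm.eventually_lt hexp hlt),
    mem_nhdsWithin_of_mem_nhds (hτ.eventually_const_lt (htT'.trans_eq hτw.symm))]
    with u hu hlt_u hτu
  have hux : u * τ u = w * t := mul_div_cancel₀ _ (hW hu).ne'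
  refine (hle' (τ u) hτu.le u hu (by rwa [hux]) ?_).trans_lt hc₃y
  rw [rayRate_le_iff (hT'.trans hτu), hux]
  exact hlt_u.le

theorem exists_neg_forall_le_of_upperSemicontinuousOn {α : Type*} [TopologicalSpace α] {K : Set α}
    (hK : IsCompact K) {g : α → EReal} (hg : UpperSemicontinuousOn g K) (hneg : ∀ u ∈ K, g u < 0) :
    ∃ c : ℝ, c < 0 ∧ ∀ u ∈ K, g u ≤ c := by
  obtain rfl | hne := K.eq_empty_or_nonempty
  · exact ⟨-1, by norm_num, by simp⟩
  obtain ⟨a, ha, hmax⟩ := hg.exists_isMaxOn hne hK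
  obtain ⟨c, hac, hc⟩ := EReal.lt_iff_exists_real_btwn.1 (hneg a ha)
  exact ⟨c, by exact_mod_cast hc, fun u hu => (hmax hu).trans hac.le⟩

theorem HasUniformRate.exists_norm_le_exp_neg (h : HasUniformRate f X W lam) (hX : ¬ BddAbove X)
    (hW : W ⊆ Set.Ioi 0) (hf : ∀ x ∈ X, ContinuousOn (f x) (Set.Ioi 0)) {K : Set ℝ}
    (hK : IsCompact K) (hKW : K ⊆ W) (hneg : ∀ u ∈ K, lam u < 0) :
    ∃ ε T : ℝ, 0 < ε ∧ ∀ t, T ≤ t → ∀ u ∈ K, u * t ∈ X →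
      ‖f (u * t) t‖ ≤ Real.exp (-(ε * t)) := by
  obtain ⟨c, hc, hle⟩ := exists_neg_forall_le_of_upperSemicontinuousOn hK
    ((h.upperSemicontinuousOn hX hW hf).mono hKW) hneg
  obtain ⟨b, hcb, hb⟩ := exists_between hc
  obtain ⟨T, hT, hrate⟩ := h.exists_rayRate_le hcb
  refine ⟨-b, T, neg_pos.2 hb, fun t ht u hu huX => ?_⟩
  rw [neg_mul, neg_neg]
  exact (rayRate_le_iff (hT.trans_le ht) b).1 (hrate t ht u (hKW hu) huX (hle u hu))

/-- The field `f` is bounded, and exponentially small outside the cone `x ≤ v t`. -/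
def HasConeBound (f : ℝ → ℝ → E) (X : Set ℝ) (v : ℝ) : Prop :=
  ∃ ξ C : ℝ, 0 < ξ ∧ 0 < C ∧ ∀ t x, 0 < t → 0 < x → x ∈ X →
    ‖f x t‖ ≤ C * min 1 (Real.exp ((v * t - x) / ξ))

theorem hasConeBound_of_norm_le {v ξ C C' : ℝ} (hξ : 0 < ξ)
    (hle : ∀ t x, 0 < t → 0 < x → x ∈ X → ‖f x t‖ ≤ C)
    (hout : ∀ t x, 0 < t → 0 < x → x ∈ X → v * t < x →
      ‖f x t‖ ≤ C' * Real.exp ((v * t - x) / ξ)) : HasConeBound f X v := by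
  let M := max (max C C') 1
  have hM : 0 < M := lt_max_of_lt_right one_pos
  have hCM : C ≤ M := (le_max_left _ _).trans (le_max_left _ _)
  have hCM' : C' ≤ M := (le_max_right _ _).trans (le_max_left _ _)
  refine ⟨ξ, M, hξ, hM, fun t x ht hx hxX => ?_⟩
  have hM_le : ‖f x t‖ ≤ M := (hle t x ht hx hxX).trans hCM
  rw [mul_min_of_nonneg _ _ hM.le, mul_one]
  refine le_min hM_le ?_
  obtain hin | hlt := le_or_gt x (v * t)
  · exact hM_le.trans (le_mul_of_one_le_right hM.le
      (Real.one_le_exp (div_nonneg (sub_nonneg.2 hin) hξ.le)))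
  · exact (hout t x ht hx hxX hlt).trans (by gcongr)

theorem HasConeBound.exists_norm_le {v : ℝ} (h : HasConeBound f X v) :
    ∃ C, ∀ t x, 0 < t → 0 < x → x ∈ X → ‖f x t‖ ≤ C := by
  obtain ⟨ξ, C, -, hC, hcone⟩ := h
  exact ⟨C, fun t x ht hx hxX =>
    (hcone t x ht hx hxX).trans (mul_le_of_le_one_right hC.le (min_le_left _ _))⟩

theorem HasConeBound.exists_norm_le_of_two_mul_le {v : ℝ} (h : HasConeBound f X v) :
    ∃ ξ C : ℝ, 0 < ξ ∧ 0 < C ∧ ∀ t x, 0 < t → 0 < x → x ∈ X → 2 * (v * t) ≤ x →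
      ‖f x t‖ ≤ C * Real.exp (-(x / ξ)) := by
  obtain ⟨ξ, C, hξ, hC, hcone⟩ := h
  refine ⟨2 * ξ, C, by positivity, hC, fun t x ht hx hxX hxt => ?_⟩
  refine (hcone t x ht hx hxX).trans ?_
  gcongr
  refine (min_le_right _ _).trans (Real.exp_le_exp.2 ?_)
  rw [← neg_div, div_le_div_iff₀ hξ (by positivity)]
  nlinarith

theorem exists_norm_le_mul_exp_neg {K : Set ℝ} {C ε T : ℝ} (hε : 0 < ε)
    (hC : ∀ t x, 0 < t → 0 < x → x ∈ X → ‖f x t‖ ≤ C)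
    (hdecay : ∀ t, T ≤ t → ∀ u ∈ K, u * t ∈ X → ‖f (u * t) t‖ ≤ Real.exp (-(ε * t))) :
    ∃ C', ∀ t x, 0 < t → 0 < x → x ∈ X → x / t ∈ K → ‖f x t‖ ≤ C' * Real.exp (-(ε * t)) := by
  refine ⟨max (C * Real.exp (ε * T)) 1, fun t x ht hx hxX hxt => ?_⟩
  obtain htT | htT := lt_or_ge t T
  · calc ‖f x t‖ ≤ C := hC t x ht hx hxX
      _ ≤ C * Real.exp (ε * (T - t)) :=
        le_mul_of_one_le_right ((norm_nonneg _).trans (hC t x ht hx hxX))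
          (Real.one_le_exp (mul_nonneg hε.le (sub_nonneg.2 htT.le)))
      _ = C * Real.exp (ε * T) * Real.exp (-(ε * t)) := by
        rw [mul_assoc, ← Real.exp_add, mul_sub, sub_eq_add_neg]
      _ ≤ max (C * Real.exp (ε * T)) 1 * Real.exp (-(ε * t)) := by
        gcongr
        exact le_max_left _ _
  · have hdiv : x / t * t = x := div_mul_cancel₀ _ ht.ne'
    have hx_decay := hdecay t htT (x / t) hxt (by rwa [hdiv])
    rw [hdiv] at hx_decay
    exact hx_decay.trans (le_mul_of_one_le_left (Real.exp_pos _).le (le_max_right _ _))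

theorem HasConeBound.of_exp_decay {v v₀ ε T : ℝ} (h₀ : HasConeBound f X v₀) (hv : 0 < v)
    (hε : 0 < ε)
    (hdecay : ∀ t, T ≤ t → ∀ u ∈ Set.Icc v (2 * v₀), u * t ∈ X →
      ‖f (u * t) t‖ ≤ Real.exp (-(ε * t))) : HasConeBound f X v := by
  obtain ⟨C₀, hle⟩ := h₀.exists_norm_le
  obtain ⟨ξ₁, C₁, hξ₁, hC₁, hfar⟩ := h₀.exists_norm_le_of_two_mul_le
  obtain ⟨C₂, hnear⟩ := exists_norm_le_mul_exp_neg hε hle hdecay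
  let ξ := max ξ₁ (2 * v₀ / ε)
  let C := max C₁ C₂
  have hξ : 0 < ξ := lt_max_of_lt_left hξ₁
  have : 0 ≤ C := hC₁.le.trans (le_max_left _ _)
  refine hasConeBound_of_norm_le (C' := C) hξ hle fun t x ht hx hxX hvx => ?_
  have hexp : Real.exp (-(x / ξ)) ≤ Real.exp ((v * t - x) / ξ) := by
    rw [← neg_div]
    gcongr
    linarith [mul_pos hv ht]
  suffices hfx : ‖f x t‖ ≤ C * Real.exp (-(x / ξ)) from hfx.trans (by gcongr)
  obtain hxt | hxt := le_total (2 * (v₀ * t)) x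
  · refine (hfar t x ht hx hxX hxt).trans ?_
    gcongr
    · exact le_max_left _ _
    · exact le_max_left _ _
  · have hxt_mem : x / t ∈ Set.Icc v (2 * v₀) :=
      ⟨(le_div_iff₀ ht).2 hvx.le, (div_le_iff₀ ht).2 (by rwa [mul_assoc])⟩
    have hξ_le : 2 * v₀ ≤ ξ * ε := (div_le_iff₀ hε).1 (le_max_right _ _)
    refine (hnear t x ht hx hxX hxt_mem).trans ?_
    gcongr
    · exact le_max_right _ _
    · rw [div_le_iff₀ hξ]
      nlinarith

theorem HasConeBound.le_of_tendsto_rayRate {v w : ℝ} {l : EReal} (h : HasConeBound f X v)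
    (hX : ¬ BddAbove X) (hw : 0 < w) (hl : Tendsto (rayRate f w) (rayTimes X w) (𝓝 l))
    (hl₀ : 0 ≤ l) : w ≤ v := by
  obtain ⟨ξ, C, hξ, hC, hcone⟩ := h
  have := rayTimes_neBot hX hw
  have hlim : Tendsto (fun t : ℝ => ((Real.log C / t + (v - w) / ξ : ℝ) : EReal)) (rayTimes X w)
      (𝓝 (((v - w) / ξ : ℝ) : EReal)) := by
    refine (continuous_coe_real_ereal.tendsto _).comp (Tendsto.mono_left ?_ inf_le_left)
    simpa using (tendsto_const_nhds.div_atTop tendsto_id).add_const ((v - w) / ξ)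
  have hle : ∀ᶠ t in rayTimes X w,
      rayRate f w t ≤ ((Real.log C / t + (v - w) / ξ : ℝ) : EReal) := by
    rw [eventually_rayTimes]
    filter_upwards [eventually_gt_atTop 0] with t ht htX
    rw [rayRate_le_iff ht]
    calc ‖f (w * t) t‖ ≤ C * Real.exp ((v * t - w * t) / ξ) :=
          (hcone t (w * t) ht (mul_pos hw ht) htX).trans (by gcongr; exact min_le_right _ _)
      _ = Real.exp ((Real.log C / t + (v - w) / ξ) * t) := by
          rw [add_mul, div_mul_cancel₀ _ ht.ne', Real.exp_add, Real.exp_log hC]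
          ring_nf
  have hnonneg : 0 ≤ (v - w) / ξ := by
    exact_mod_cast hl₀.trans (le_of_tendsto_of_tendsto hl hlim hle)
  rwa [le_div_iff₀ hξ, zero_mul, sub_nonneg] at hnonneg

/-- The infimum in `[0, ∞]` of the velocities `v > 0` of the cones outside which `f` is
exponentially small. -/
def coneVelocity (f : ℝ → ℝ → E) (X : Set ℝ) : ENNReal :=
  ⨅ v ∈ {v : ℝ | 0 < v ∧ HasConeBound f X v}, ENNReal.ofReal v

/-- The supremum in `[0, ∞]` of the velocities `v > 0` of the rays along which `f` does not decay
exponentially. -/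
def rayVelocity (f : ℝ → ℝ → E) (X : Set ℝ) : ENNReal :=
  ⨆ v ∈ {v : ℝ | 0 < v ∧ ∃ l, Tendsto (rayRate f v) (rayTimes X v) (𝓝 l) ∧ 0 ≤ l},
    ENNReal.ofReal v

theorem rayVelocity_le_coneVelocity (f : ℝ → ℝ → E) (hX : ¬ BddAbove X) :
    rayVelocity f X ≤ coneVelocity f X := by
  refine iSup₂_le fun w ⟨hw, l, hl, hl₀⟩ => le_iInf₂ fun v ⟨_, hv⟩ => ?_
  exact ENNReal.ofReal_le_ofReal (hv.le_of_tendsto_rayRate hX hw hl hl₀)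

theorem pos_of_rayVelocity_lt {v : ℝ} (hv : rayVelocity f X < ENNReal.ofReal v) : 0 < v :=
  ENNReal.ofReal_pos.1 (bot_le.trans_lt hv)

theorem neg_of_rayVelocity_lt {v : ℝ} {l : EReal} (hv : rayVelocity f X < ENNReal.ofReal v)
    (hl : Tendsto (rayRate f v) (rayTimes X v) (𝓝 l)) : l < 0 := by
  by_contra! hl₀
  exact hv.not_ge (le_iSup₂_of_le v ⟨pos_of_rayVelocity_lt hv, l, hl, hl₀⟩ le_rfl)

theorem HasUniformRate.hasConeBound
    (h : HasUniformRate f X {v | rayVelocity f X < ENNReal.ofReal v} lam) (hX : ¬ BddAbove X)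
    (hf : ∀ x ∈ X, ContinuousOn (f x) (Set.Ioi 0)) {v₀ : ℝ}
    (hcone : HasConeBound f X v₀) {v : ℝ} (hv : rayVelocity f X < ENNReal.ofReal v) :
    HasConeBound f X v := by
  have hIcc : Set.Icc v (2 * v₀) ⊆ {v | rayVelocity f X < ENNReal.ofReal v} := fun u hu =>
    hv.trans_le (ENNReal.ofReal_le_ofReal hu.1)
  obtain ⟨ε, T, hε, hdecay⟩ := h.exists_norm_le_exp_neg hX (fun u hu => pos_of_rayVelocity_lt hu)
    hf isCompact_Icc hIcc fun u hu => neg_of_rayVelocity_lt (hIcc hu) (h.tendsto_rayRate (hIcc hu))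
  exact hcone.of_exp_decay (pos_of_rayVelocity_lt hv) hε hdecay

theorem HasUniformRate.coneVelocity_eq_rayVelocity
    (h : HasUniformRate f X {v | rayVelocity f X < ENNReal.ofReal v} lam) (hX : ¬ BddAbove X)
    (hf : ∀ x ∈ X, ContinuousOn (f x) (Set.Ioi 0)) (hfin : coneVelocity f X < ⊤) :
    coneVelocity f X = rayVelocity f X := by
  obtain ⟨v₀, ⟨-, hcone⟩, -⟩ := by simpa only [coneVelocity, iInf_lt_iff] using hfin
  refine le_antisymm (le_of_forall_gt_imp_ge_of_dense fun c hc => ?_)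
    (rayVelocity_le_coneVelocity f hX)
  obtain rfl | hc_top := eq_or_ne c ⊤
  · exact le_top
  rw [← ENNReal.ofReal_toReal hc_top] at hc ⊢
  exact iInf₂_le _ ⟨pos_of_rayVelocity_lt hc, h.hasConeBound hX hf hcone hc⟩

end Rates

section Velocities

variable {d : ℕ} {Λ : Submodule ℤ (Space d)} {q : ℕ} [NeZero q]
  (H : Hamiltonian Λ q) {X : Set ℝ} {A B : Op Λ q}

theorem velocity₂_eq_rayVelocity (p : ℝ → Λ) :
    velocity₂ H X p A B = rayVelocity (fun x t => H.commutator A B t (p x)) X := rfl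

theorem uniformRayLimit_iff_hasUniformRate (p : ℝ → Λ) (W : Set ℝ) (lam : ℝ → EReal) :
    UniformRayLimit H X p A B W lam ↔
      HasUniformRate (fun x t => H.commutator A B t (p x)) X W lam := Iff.rfl

variable [DiscreteTopology Λ]

theorem liebRobinsonBound_iff_hasConeBound (p : ℝ → Λ) (hA : IsLocal A) (v : ℝ) :
    LiebRobinsonBound H X p A B v ↔ HasConeBound (fun x t => H.commutator A B t (p x)) X v := by
  obtain hAB | hAB := (mul_nonneg (norm_nonneg A) (norm_nonneg B)).eq_or_lt
  · have hzero : ∀ t y, H.commutator A B t y = 0 := fun t y => by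
      rw [← norm_le_zero_iff]
      simpa only [mul_assoc, ← hAB, mul_zero] using H.norm_commutator_le hA B t y
    simp only [LiebRobinsonBound, HasConeBound, hzero, norm_zero]
    refine iff_of_true ?_ ?_ <;> exact ⟨1, 1, one_pos, one_pos, fun _ _ _ _ _ => by positivity⟩
  · constructor
    · rintro ⟨ξ, C, hξ, hC, h⟩
      refine ⟨ξ, C * (‖A‖ * ‖B‖), hξ, by positivity, fun t x ht hx hxX => ?_⟩
      simpa only [mul_assoc] using h t x ht hx hxX
    · rintro ⟨ξ, C, hξ, hC, h⟩
      refine ⟨ξ, C / (‖A‖ * ‖B‖), hξ, by positivity, fun t x ht hx hxX => ?_⟩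
      rw [mul_assoc (C / _), div_mul_cancel₀ _ hAB.ne']
      exact h t x ht hx hxX

theorem velocity₁_eq_coneVelocity (p : ℝ → Λ) (hA : IsLocal A) :
    velocity₁ H X p A B = coneVelocity (fun x t => H.commutator A B t (p x)) X := by
  simp only [velocity₁, coneVelocity, liebRobinsonBound_iff_hasConeBound H p hA]

theorem exists_hasConeBound_commutator {p : ℝ → Λ} (hA : IsLocal A) (hB : IsLocal B) {c K : ℝ}
    (hc : 0 < c) (hp : ∀ x ∈ X, c * x - K ≤ ‖p x‖) :
    ∃ v, 0 < v ∧ HasConeBound (fun x t => H.commutator A B t (p x)) X v := by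
  obtain ⟨C, v, hv, hle⟩ := H.exists_norm_commutator_le hA hB
  refine ⟨v / c, div_pos hv hc, hasConeBound_of_norm_le (C' := C * Real.exp K) (inv_pos.2 hc)
    (fun t x _ _ _ => H.norm_commutator_le hA B t (p x)) fun t x ht _ hxX _ => ?_⟩
  have hC : 0 ≤ C := nonneg_of_mul_nonneg_left ((norm_nonneg _).trans (hle 0 0)) (Real.exp_pos _)
  calc ‖H.commutator A B t (p x)‖ ≤ C * Real.exp (v * |t| - ‖p x‖) := hle t (p x)
    _ ≤ C * Real.exp (K + (v / c * t - x) / c⁻¹) := by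
        rw [abs_of_pos ht, div_inv_eq_mul, sub_mul, mul_right_comm, div_mul_cancel₀ _ hc.ne']
        gcongr
        linarith [hp x hxX]
    _ = C * Real.exp K * Real.exp ((v / c * t - x) / c⁻¹) := by rw [Real.exp_add, mul_assoc]

theorem velocity₁_lt_top {p : ℝ → Λ} (hA : IsLocal A) (hB : IsLocal B) {c K : ℝ} (hc : 0 < c)
    (hp : ∀ x ∈ X, c * x - K ≤ ‖p x‖) : velocity₁ H X p A B < ⊤ := by
  obtain ⟨v, hv⟩ := exists_hasConeBound_commutator H hA hB hc hp
  rw [velocity₁_eq_coneVelocity H p hA]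
  exact (iInf₂_le v hv).trans_lt ENNReal.ofReal_lt_top

end Velocities

theorem sub_le_norm_of_norm_sub_smul_le {E : Type*} [SeminormedAddCommGroup E] [NormedSpace ℝ E]
    {n y : E} (hn : ‖n‖ = 1) {x K : ℝ} (h : ‖y - x • n‖ ≤ K) : x - K ≤ ‖y‖ := by
  have hx : x ≤ ‖x • n‖ := by
    rw [norm_smul, hn, mul_one]
    exact Real.le_norm_self x
  linarith [norm_sub_norm_le (x • n) y, norm_sub_rev y (x • n)]

end SpinLattice

end

theorem mainTheorem7_general {d : ℕ} (Λ : Submodule ℤ (SpinLattice.Space d)) [DiscreteTopology Λ]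
    (q : ℕ) [NeZero q] (H : SpinLattice.Hamiltonian Λ q)
    (X : Set ℝ) (hX : ¬ BddAbove X) (p : ℝ → Λ)
    (hp : ∃ c > 0, ∃ K : ℝ, ∀ x ∈ X, c * x - K ≤ ‖p x‖)
    (O₁ O₂ : SpinLattice.Op Λ q)
    (hO₁ : SpinLattice.IsLocal O₁) (hO₂ : SpinLattice.IsLocal O₂) :
    (∀ t : ℝ, Tendsto (fun V : Finset Λ => H.evolveIn V t O₁) atTop (𝓝 (H.evolve t O₁))) ∧
    SpinLattice.velocity₁ H X p O₁ O₂ < ⊤ ∧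
    SpinLattice.velocity₂ H X p O₁ O₂ ≤ SpinLattice.velocity₁ H X p O₁ O₂ ∧
    (∀ lam : ℝ → EReal,
      SpinLattice.UniformRayLimit H X p O₁ O₂
        {v : ℝ | SpinLattice.velocity₂ H X p O₁ O₂ < ENNReal.ofReal v} lam →
      SpinLattice.velocity₁ H X p O₁ O₂ = SpinLattice.velocity₂ H X p O₁ O₂) := by
  obtain ⟨c, hc, K, hcK⟩ := hp
  have hfin := SpinLattice.velocity₁_lt_top H hO₁ hO₂ hc hcK
  refine ⟨H.tendsto_evolveIn hO₁, hfin, ?_, fun lam hlam => ?_⟩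
  · rw [SpinLattice.velocity₁_eq_coneVelocity H p hO₁, SpinLattice.velocity₂_eq_rayVelocity]
    exact SpinLattice.rayVelocity_le_coneVelocity _ hX
  · rw [SpinLattice.velocity₂_eq_rayVelocity,
      SpinLattice.uniformRayLimit_iff_hasUniformRate] at hlam
    rw [SpinLattice.velocity₁_eq_coneVelocity H p hO₁] at hfin
    rw [SpinLattice.velocity₁_eq_coneVelocity H p hO₁, SpinLattice.velocity₂_eq_rayVelocity]
    exact hlam.coneVelocity_eq_rayVelocity hX
      (fun x _ => (H.continuous_commutator hO₁ O₂ (p x)).continuousOn) hfin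

theorem mainTheorem7 {d : ℕ} (Λ : Submodule ℤ (SpinLattice.Space d)) [DiscreteTopology Λ]
    [IsZLattice ℝ Λ] (q : ℕ) [NeZero q] (H : SpinLattice.Hamiltonian Λ q)
    (n : SpinLattice.Space d) (hn : ‖n‖ = 1)
    (X : Set ℝ) (hX : ¬ BddAbove X) (p : ℝ → Λ)
    (hp : ∃ K : ℝ, ∀ x ∈ X, ‖(p x : SpinLattice.Space d) - x • n‖ ≤ K)
    (O₁ O₂ : SpinLattice.Op Λ q)
    (hO₁ : SpinLattice.IsLocal O₁) (hO₂ : SpinLattice.IsLocal O₂) :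
    (∀ t : ℝ, Tendsto (fun V : Finset Λ => H.evolveIn V t O₁) atTop (𝓝 (H.evolve t O₁))) ∧
    SpinLattice.velocity₁ H X p O₁ O₂ < ⊤ ∧
    SpinLattice.velocity₂ H X p O₁ O₂ ≤ SpinLattice.velocity₁ H X p O₁ O₂ ∧
    (∀ lam : ℝ → EReal,
      SpinLattice.UniformRayLimit H X p O₁ O₂
        {v : ℝ | SpinLattice.velocity₂ H X p O₁ O₂ < ENNReal.ofReal v} lam →
      SpinLattice.velocity₁ H X p O₁ O₂ ≤ SpinLattice.velocity₂ H X p O₁ O₂ ∧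
      SpinLattice.velocity₁ H X p O₁ O₂ = SpinLattice.velocity₂ H X p O₁ O₂) := by
  obtain ⟨K, hK⟩ := hp
  obtain ⟨hlim, hfin, hle, heq⟩ := mainTheorem7_general Λ q H X hX p
    ⟨1, one_pos, K, fun x hx => by
      simpa only [one_mul] using! SpinLattice.sub_le_norm_of_norm_sub_smul_le hn (hK x hx)⟩
    O₁ O₂ hO₁ hO₂
  exact ⟨hlim, hfin, hle, fun lam hlam => ⟨(heq lam hlam).le, heq lam hlam⟩⟩
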